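/- **Setting.** Let $n\ge 3$ and let $\mathbb H$ be a real, complex or quaternionic hyperbolic space (curvatures in $[-4,-1]$) with distance $\operatorname{dist}$; geodesics are complete and unit speed. Let $\Sigma_1,\dots,\Sigma_{N+1}\subset\mathbb R^n$ ($N\ge 0$) be disjoint, connected, closed smooth submanifolds of codimension at least $2$, possibly with boundary. Put $\Sigma=\bigcup_j\Sigma_j$, $J=\{j:\Sigma_j\text{ bounded}\}$ and $\widetilde\Sigma=\bigcup_{j\notin J}\Sigma_j$. For $\Omega\subset\mathbb R^n$ open and $S\subset\mathbb R^n$ closed, a harmonic map $\varphi\colon\Omega\setminus S\to\mathbb H$ is a map in $C^\infty(\overline\Omega\setminus S;\mathbb H)$ satisfying the harmonic map equation $\Delta\varphi^a+\sum_{i}\Gamma^a_{bc}(\varphi)\,\partial_i\varphi^b\,\partial_i\varphi^c=0$ in $\Omega\setminus S$. Two maps $\varphi,\varphi'$ on $\Omega\setminus S$ are asymptotic near a set $S'$ if there is an open $V\subset\mathbb R^n$ with $S'\subset V$ such that $\operatorname{dist}(\varphi,\varphi')$ is bounded on $(V\cap\Omega)\setminus S$. A harmonic map $\varphi\colon\mathbb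 R^n\setminus\Sigma\to\mathbb H$ is $\Sigma$-singular into a geodesic $\gamma$ if $\varphi(\mathbb R^n\setminus\Sigma)\subset\gamma(\mathbb R)$, if $\varphi(x)\to\gamma(+\infty)$ as $x\to\Sigma$, and if there is $\delta>0$ with $|d\varphi(x)|^2\ge\delta\operatorname{dist}(x,\Sigma)^{-2}$ in some neighbourhood of $\Sigma$. **Data.** Let $(\varphi_1,\dots,\varphi_{N+1},\tilde\varphi)$ be singular Dirichlet data, i.e. 1. $\varphi_j\colon\mathbb R^n\setminus\Sigma\to\mathbb H$ is a $\Sigma$-singular harmonic map into a geodesic $\gamma_j$ of $\mathbb H$; 2. $|\operatorname{dist}(p_0,\varphi_j)-\operatorname{dist}(p_0,\varphi_{j'})|\le C$ on $\mathbb R^n\setminus\Sigma$ for all $j,j'$, for some point $p_0\in\mathbb H$ and some constant $C$; 3. $\tilde\varphi\colon\mathbb R^n\setminus\widetilde\Sigma\to\mathbb H$ is a harmonic map which is asymptotic to $\varphi_j$ near $\Sigma_j$ for each $j\notin J$; 4. there is a compact $K\subset\mathbb R^n$ such that $\operatorname{dist}(\tilde\varphi(x),\gamma_j(\mathbb R))\to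 0$ as $x\to\Sigma_j\setminus K$, for each $j\notin J$. Let $\{\Omega'_1,\dots,\Omega'_{N+1},\widetilde\Omega'\}$ be an open cover of $\mathbb R^n$ with $\Sigma_j\subset\Omega'_j$, with $\overline{\Omega'_i}\cap\Sigma_j=\emptyset$ for $i\ne j$, with $\overline{\widetilde\Omega'}\cap\Sigma=\emptyset$, with $\Omega'_j$ bounded for $j\in J$, and with $\operatorname{dist}(\tilde\varphi,\varphi_j)$ bounded on $\Omega'_j\setminus\Sigma_j$ for $j\notin J$. **Proposition.** There is a constant $R>0$ such that the following holds for every open ball $B\subset\mathbb R^n$ with $\overline{\Omega'_j}\subset B$ for all $j\in J$. Put $\Omega_j=\Omega'_j\cap B$ and $\widetilde\Omega=\widetilde\Omega'\cap B$. If $\varphi\colon B\setminus\Sigma\to\mathbb H$ is a harmonic map that is asymptotic to $\varphi_j$ near $\Sigma_j$ for every $j=1,\dots,N+1$ and satisfies $\varphi=\tilde\varphi$ on $\partial B\setminus\Sigma$, then $$\operatorname{dist}(\varphi,\tilde\varphi)\le R\ \text{ in }\widetilde\Omega,\qquad \operatorname{dist}(\varphi,\varphi_j)\le R\ \text{ in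 }\Omega_j\setminus\Sigma_j,\quad j=1,\dots,N+1.$$ -/

import Mathlib

open scoped ContDiff Topology Laplacian

/-! ## The scalars: real numbers, complex numbers, quaternions -/

/-- The scalars of a classical hyperbolic space: a real finite-dimensional associative division
algebra `F` with a Euclidean multiplicative norm and a conjugation satisfying `ā a = ‖a‖²`.
By Frobenius' theorem these are exactly `ℝ`, `ℂ` and the quaternions `ℍ[ℝ]` (instances below). -/
class HyperbolicScalars (F : Type) [NormedDivisionRing F] [StarRing F] [InnerProductSpace ℝ F] :
    Prop extends IsScalarTower ℝ F F, SMulCommClass ℝ F F, FiniteDimensional ℝ F where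
  star_mul_self_eq : ∀ a : F, star a * a = (‖a‖ ^ 2 : ℝ) • (1 : F)

instance : HyperbolicScalars ℝ where
  star_mul_self_eq a := by simp [pow_two]

instance : HyperbolicScalars ℂ where
  star_mul_self_eq a := by
    have h := Complex.conj_mul' a
    simp only [Complex.real_smul, mul_one]
    rw [Complex.ofReal_pow]
    exact h

instance : HyperbolicScalars (Quaternion ℝ) where
  star_mul_self_eq a := by
    rw [Quaternion.star_mul_self, Quaternion.normSq_eq_norm_mul_self, ← pow_two,
      ← Algebra.algebraMap_eq_smul_one, Quaternion.algebraMap_def]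

/-! ## Hyperbolic space over `F`, in the projective ball model

The point `p` of the open unit ball of `Fᵏ` stands for the negative line of `F^{k,1}` spanned by
`(p, 1)`. Sectional curvatures lie in `[-4, -1]` (all equal to `-1` when `F = ℝ`). -/

/-- The `F`-valued Hermitian product `⟨p, q⟩ = ∑ᵢ p̄ᵢ qᵢ` on `Fᵏ`. -/
noncomputable def hermProd {F : Type} [NormedDivisionRing F] [StarRing F] {k : ℕ}
    (p q : EuclideanSpace F (Fin k)) : F :=
  ∑ i, star (p i) * q i

/-- The `F`-hyperbolic space of `F`-dimension `k`, as the open unit ball of `Fᵏ`. -/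
def hypSpace (F : Type) [NormedDivisionRing F] (k : ℕ) : Set (EuclideanSpace F (Fin k)) :=
  Metric.ball 0 1

/-- The hyperbolic distance,
`cosh d(p, q) = |1 - ⟨p, q⟩| / √((1 - |p|²)(1 - |q|²))`. -/
noncomputable def hypDist {F : Type} [NormedDivisionRing F] [StarRing F] {k : ℕ}
    (p q : EuclideanSpace F (Fin k)) : ℝ :=
  Real.arcosh (‖1 - hermProd p q‖ / Real.sqrt ((1 - ‖p‖ ^ 2) * (1 - ‖q‖ ^ 2)))

/-- The Riemannian metric of hyperbolic space, the polarization of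
`ds² = ((1 - |p|²) |dp|² + |⟨p, dp⟩|²) / (1 - |p|²)²`. -/
noncomputable def hypMetric {F : Type} [NormedDivisionRing F] [StarRing F]
    [InnerProductSpace ℝ F] {k : ℕ} (p X Y : EuclideanSpace F (Fin k)) : ℝ :=
  ((1 - ‖p‖ ^ 2) * inner ℝ X Y + inner ℝ (hermProd p X) (hermProd p Y)) / (1 - ‖p‖ ^ 2) ^ 2

/-- The Christoffel symbols of the first kind of the hyperbolic metric `g`, that is
`g(Γ(X, Y), Z) = (X·g(Y, Z) + Y·g(X, Z) - Z·g(X, Y)) / 2` for constant fields `X, Y, Z`. -/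
noncomputable def hypChristoffel {F : Type} [NormedDivisionRing F] [StarRing F]
    [InnerProductSpace ℝ F] {k : ℕ} (p X Y Z : EuclideanSpace F (Fin k)) : ℝ :=
  (fderiv ℝ (fun q => hypMetric q Y Z) p X + fderiv ℝ (fun q => hypMetric q X Z) p Y
    - fderiv ℝ (fun q => hypMetric q X Y) p Z) / 2

/-- `γ : ℝ → ℍ` is a (complete, unit speed) geodesic. Hyperbolic space being a Hadamard manifold,
these are the isometric embeddings of the real line. -/
def IsHypGeodesic {F : Type} [NormedDivisionRing F] [StarRing F] {k : ℕ}
    (γ : ℝ → EuclideanSpace F (Fin k)) : Prop :=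
  (∀ t, γ t ∈ hypSpace F k) ∧ ∀ s t, hypDist (γ s) (γ t) = |s - t|

/-- The distance from `p` to the set `γ(ℝ)`. -/
noncomputable def hypDistToGeodesic {F : Type} [NormedDivisionRing F] [StarRing F] {k : ℕ}
    (p : EuclideanSpace F (Fin k)) (γ : ℝ → EuclideanSpace F (Fin k)) : ℝ :=
  ⨅ t : ℝ, hypDist p (γ t)

/-! ## Harmonic maps into hyperbolic space -/

/-- The partial derivative `∂ᵢ φ(x)`. -/
noncomputable def partialDeriv {F : Type} [NormedDivisionRing F] [InnerProductSpace ℝ F]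
    {n k : ℕ} (φ : EuclideanSpace ℝ (Fin n) → EuclideanSpace F (Fin k)) (i : Fin n)
    (x : EuclideanSpace ℝ (Fin n)) : EuclideanSpace F (Fin k) :=
  fderiv ℝ φ x (EuclideanSpace.single i 1)

/-- The energy density `|dφ|² = ∑ᵢ ⟨∂ᵢφ, ∂ᵢφ⟩`. -/
noncomputable def energyDensity {F : Type} [NormedDivisionRing F] [StarRing F]
    [InnerProductSpace ℝ F] {n k : ℕ}
    (φ : EuclideanSpace ℝ (Fin n) → EuclideanSpace F (Fin k)) (x : EuclideanSpace ℝ (Fin n)) : ℝ :=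
  ∑ i, hypMetric (φ x) (partialDeriv φ i x) (partialDeriv φ i x)

/-- `φ : Ω \ S → ℍ` is a harmonic map: it is smooth on `closure Ω \ S`, with values in hyperbolic
space, and it satisfies `Δφᵃ + ∑ᵢ Γᵃ_{bc}(φ) ∂ᵢφᵇ ∂ᵢφᶜ = 0` in `Ω \ S` (with the index `a` lowered
by the metric). Values of `φ` off `closure Ω \ S` are irrelevant. -/
structure IsHarmonicMap {F : Type} [NormedDivisionRing F] [StarRing F]
    [InnerProductSpace ℝ F] {n k : ℕ} (Ω S : Set (EuclideanSpace ℝ (Fin n)))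
    (φ : EuclideanSpace ℝ (Fin n) → EuclideanSpace F (Fin k)) : Prop where
  smooth : ContDiffOn ℝ ∞ φ (closure Ω \ S)
  mapsTo : Set.MapsTo φ (closure Ω \ S) (hypSpace F k)
  harmonic : ∀ x ∈ Ω \ S, ∀ Z : EuclideanSpace F (Fin k),
    hypMetric (φ x) (Δ φ x) Z
      + ∑ i, hypChristoffel (φ x) (partialDeriv φ i x) (partialDeriv φ i x) Z = 0

/-- Two maps `φ, ψ : Ω \ S → ℍ` are asymptotic near `S'`: their distance is bounded on the part of
their domain in some neighbourhood (in `ℝⁿ`) of `S'`. -/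
def AsymptoticNear {F : Type} [NormedDivisionRing F] [StarRing F] {n k : ℕ}
    (Ω S S' : Set (EuclideanSpace ℝ (Fin n)))
    (φ ψ : EuclideanSpace ℝ (Fin n) → EuclideanSpace F (Fin k)) : Prop :=
  ∃ V : Set (EuclideanSpace ℝ (Fin n)), IsOpen V ∧ S' ⊆ V ∧
    ∃ C : ℝ, ∀ x ∈ (V ∩ Ω) \ S, hypDist (φ x) (ψ x) ≤ C

/-- `φ : ℝⁿ \ S → ℍ` is an `S`-singular harmonic map into the geodesic `γ`. As `φ` has values in
`γ(ℝ)`, convergence to `γ(+∞)` at `S` says that near `S` the values of `φ` lie in `γ([T, ∞))`,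
for each `T`. -/
structure IsSingularMapInto {F : Type} [NormedDivisionRing F] [StarRing F]
    [InnerProductSpace ℝ F] {n k : ℕ} (S : Set (EuclideanSpace ℝ (Fin n)))
    (γ : ℝ → EuclideanSpace F (Fin k))
    (φ : EuclideanSpace ℝ (Fin n) → EuclideanSpace F (Fin k)) : Prop where
  harmonic : IsHarmonicMap Set.univ S φ
  mem_geodesic : ∀ x ∉ S, φ x ∈ Set.range γ
  tendsto_end : ∀ T : ℝ, ∀ᶠ x in 𝓝ˢ S ⊓ Filter.principal Sᶜ, φ x ∈ γ '' Set.Ici T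
  energy_lower : ∃ δ : ℝ, 0 < δ ∧ ∀ᶠ x in 𝓝ˢ S ⊓ Filter.principal Sᶜ,
    δ / Metric.infDist x S ^ 2 ≤ energyDensity φ x

/-! ## The singular set and the data -/

/-- `S` is a smooth embedded submanifold of `ℝⁿ` of dimension `d`, possibly with boundary: near
each of its points a diffeomorphism straightens `S` to the coordinate plane `{y_d = y_{d+1} = … = 0}`
(indices start at `0`) or to the half-plane of it where the last free coordinate is `≥ 0`. -/
def IsSmoothSubmanifold {n : ℕ} (d : ℕ) (S : Set (EuclideanSpace ℝ (Fin n))) : Prop :=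
  ∀ a ∈ S, ∃ Ψ : OpenPartialHomeomorph (EuclideanSpace ℝ (Fin n)) (EuclideanSpace ℝ (Fin n)),
    a ∈ Ψ.source ∧ ContDiffOn ℝ ∞ Ψ Ψ.source ∧ ContDiffOn ℝ ∞ Ψ.symm Ψ.target ∧
    ((∀ x ∈ Ψ.source, x ∈ S ↔ ∀ i : Fin n, d ≤ (i : ℕ) → Ψ x i = 0) ∨
     (∀ x ∈ Ψ.source, x ∈ S ↔
        (∀ i : Fin n, d ≤ (i : ℕ) → Ψ x i = 0) ∧ ∀ i : Fin n, (i : ℕ) + 1 = d → 0 ≤ Ψ x i))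

/-- The components of the singular set: finitely many disjoint smooth connected closed
submanifolds of `ℝⁿ` of codimension at least two, possibly with boundary. -/
structure IsSingularSet {n N : ℕ} (S : Fin (N + 1) → Set (EuclideanSpace ℝ (Fin n))) : Prop where
  submanifold : ∀ j, ∃ d : ℕ, d + 2 ≤ n ∧ IsSmoothSubmanifold d (S j)
  closed : ∀ j, IsClosed (S j)
  connected : ∀ j, IsConnected (S j)
  disjoint : ∀ i j, i ≠ j → Disjoint (S i) (S j)

/-- The union of the unbounded components. -/
def unboundedPart {n N : ℕ} (S : Fin (N + 1) → Set (EuclideanSpace ℝ (Fin n))) :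
    Set (EuclideanSpace ℝ (Fin n)) :=
  ⋃ (j : Fin (N + 1)) (_ : ¬ Bornology.IsBounded (S j)), S j

/-- Singular Dirichlet data `(φ₁, …, φ_{N+1}, φ̃)` on `ℝⁿ \ ⋃ⱼ Sⱼ`, with geodesics `γⱼ`. -/
structure IsSingularDirichletData {F : Type} [NormedDivisionRing F] [StarRing F]
    [InnerProductSpace ℝ F] {n N k : ℕ} (S : Fin (N + 1) → Set (EuclideanSpace ℝ (Fin n)))
    (γ : Fin (N + 1) → ℝ → EuclideanSpace F (Fin k))
    (φs : Fin (N + 1) → EuclideanSpace ℝ (Fin n) → EuclideanSpace F (Fin k))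
    (φt : EuclideanSpace ℝ (Fin n) → EuclideanSpace F (Fin k)) : Prop where
  geodesic : ∀ j, IsHypGeodesic (γ j)
  singular : ∀ j, IsSingularMapInto (⋃ i, S i) (γ j) (φs j)
  dist_bounded : ∃ p₀ ∈ hypSpace F k, ∃ C : ℝ, ∀ i j, ∀ x ∉ ⋃ i, S i,
    |hypDist p₀ (φs i x) - hypDist p₀ (φs j x)| ≤ C
  harmonic_tilde : IsHarmonicMap Set.univ (unboundedPart S) φt
  asymptotic_tilde : ∀ j, ¬ Bornology.IsBounded (S j) →
    AsymptoticNear Set.univ (⋃ i, S i) (S j) φt (φs j)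
  tilde_to_geodesic : ∃ K : Set (EuclideanSpace ℝ (Fin n)), IsCompact K ∧
    ∀ j, ¬ Bornology.IsBounded (S j) →
      Filter.Tendsto (fun x => hypDistToGeodesic (φt x) (γ j))
        (𝓝ˢ (S j \ K) ⊓ Filter.principal (unboundedPart S)ᶜ) (𝓝 0)

/-- An open cover `{Ω'₁, …, Ω'_{N+1}, Ω̃'}` of `ℝⁿ` which separates the components `Sⱼ`, such that
`Ω'ⱼ` is bounded when `Sⱼ` is, and such that `dist (φ̃, φⱼ)` is bounded on `Ω'ⱼ \ Sⱼ` when `Sⱼ` is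
unbounded. -/
structure IsAdaptedCover {F : Type} [NormedDivisionRing F] [StarRing F]
    {n N k : ℕ} (S : Fin (N + 1) → Set (EuclideanSpace ℝ (Fin n)))
    (φs : Fin (N + 1) → EuclideanSpace ℝ (Fin n) → EuclideanSpace F (Fin k))
    (φt : EuclideanSpace ℝ (Fin n) → EuclideanSpace F (Fin k))
    (Ω' : Fin (N + 1) → Set (EuclideanSpace ℝ (Fin n)))
    (Ωt' : Set (EuclideanSpace ℝ (Fin n))) : Prop where
  isOpen : ∀ j, IsOpen (Ω' j)
  isOpen_tilde : IsOpen Ωt'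
  cover : (⋃ j, Ω' j) ∪ Ωt' = Set.univ
  subset : ∀ j, S j ⊆ Ω' j
  separates : ∀ i j, i ≠ j → Disjoint (closure (Ω' i)) (S j)
  separates_tilde : ∀ j, Disjoint (closure Ωt') (S j)
  bounded : ∀ j, Bornology.IsBounded (S j) → Bornology.IsBounded (Ω' j)
  asymptotic : ∀ j, ¬ Bornology.IsBounded (S j) →
    ∃ C : ℝ, ∀ x ∈ Ω' j \ S j, hypDist (φt x) (φs j x) ≤ C

/-- `φ` solves the singular Dirichlet problem on the domain `B`: it is a harmonic map
`B \ ⋃ⱼ Sⱼ → ℍ`, asymptotic to `φⱼ` near `Sⱼ` for each `j`, with `φ = φ̃` on `∂B \ ⋃ⱼ Sⱼ`. -/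
structure SolvesDirichletProblem {F : Type} [NormedDivisionRing F] [StarRing F]
    [InnerProductSpace ℝ F] {n N k : ℕ} (S : Fin (N + 1) → Set (EuclideanSpace ℝ (Fin n)))
    (φs : Fin (N + 1) → EuclideanSpace ℝ (Fin n) → EuclideanSpace F (Fin k))
    (φt : EuclideanSpace ℝ (Fin n) → EuclideanSpace F (Fin k))
    (B : Set (EuclideanSpace ℝ (Fin n)))
    (φ : EuclideanSpace ℝ (Fin n) → EuclideanSpace F (Fin k)) : Prop where
  harmonic : IsHarmonicMap B (⋃ i, S i) φ
  asymptotic : ∀ j, AsymptoticNear B (⋃ i, S i) (S j) φ (φs j)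
  boundary : ∀ x ∈ frontier B \ ⋃ i, S i, φ x = φt x

/-!
The distance of two harmonic maps into hyperbolic space is subharmonic. Instead of the distance `d`
the proof uses `logCosh = log cosh d`, which is smooth on the diagonal, differs from `d` by at most
`log 2`, and is still convex along pairs of geodesics (`logCosh_convexity`), so that
`logCosh (φ, ψ)` is subharmonic for harmonic `φ` and `ψ` (`laplacian_logCosh_nonneg`). The convexity
is an algebraic inequality over the scalars: after the two lifts to `F^{k,1}` are normalized to have
horizontal velocities, it reduces to two Cauchy–Schwarz inequalities for the positive definite form
on the tangent space at `p`.

The map `φ₁` into its geodesic is `γ₁ ∘ u`. The distances from `φ₁` to all the points `γ₁ s` are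
subharmonic, and this forces the height `u` to be harmonic (`IsSingularMapInto.exists_height`). As
`u` tends to infinity at the singular set `Σ`, it makes `Σ` removable for subharmonic functions
bounded above near `Σ` (`nonpos_of_laplacian_nonneg`).

A cutoff of `u` near the bounded components of `Σ`, plus a multiple of the function
`(1 + |x|²)^(-1/2)`, which is strictly superharmonic because `n ≥ 3`, gives a nonnegative
superharmonic function `v` which dominates `u` near the bounded components and is bounded on closed
sets disjoint from them
(`exists_superharmonic_of_harmonic`). Near a bounded component a solution `φ` satisfies
`d(φ, φ̃) ≤ u + O(1)`, because `φ̃` is bounded there and the maps `φⱼ` all have the growth of `φ₁`;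
near an unbounded component `d(φ, φ̃)` is bounded; and it vanishes on `∂B`. By the maximum principle
`logCosh (φ, φ̃) ≤ v` on `B \ Σ` (`SolvesDirichletProblem.logCosh_le`), and `v` does not depend on
the ball. This bounds `d(φ, φ̃)`, hence also `d(φ, φⱼ)` for unbounded `Σⱼ`, away from the bounded
components. For a bounded `Σⱼ` it bounds `d(φ, φⱼ)` on `∂Ω'ⱼ`, and the maximum principle carries
the bound to `Ω'ⱼ \ Σⱼ` (`SolvesDirichletProblem.logCosh_le_of_frontier`).
-/

set_option linter.unusedSectionVars false

/-! ### The scalars -/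

section Scalars

variable {F : Type} [NormedDivisionRing F] [StarRing F] [InnerProductSpace ℝ F]
  [HyperbolicScalars F]

theorem norm_star_eq (a : F) : ‖star a‖ = ‖a‖ := by
  rcases eq_or_ne a 0 with rfl | ha
  · simp
  have h := congrArg norm (HyperbolicScalars.star_mul_self_eq a)
  rw [norm_mul, norm_smul, norm_one, mul_one, Real.norm_of_nonneg (sq_nonneg _), sq] at h
  exact mul_right_cancel₀ (norm_ne_zero_iff.2 ha) h

/-- Polarization of `star a * a = |a|²`. -/
theorem star_mul_add_star_mul (a b : F) :
    star a * b + star b * a = (2 * inner ℝ a b : ℝ) • (1 : F) := by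
  have h := HyperbolicScalars.star_mul_self_eq (a + b)
  have h' := norm_add_sq_real a b
  rw [h', star_add, add_mul, mul_add, mul_add, HyperbolicScalars.star_mul_self_eq a,
    HyperbolicScalars.star_mul_self_eq b, add_smul, add_smul] at h
  have : star a * b + star b * a = (‖a‖ ^ 2 • 1 + star a * b + (star b * a + ‖b‖ ^ 2 • 1))
    - ‖a‖ ^ 2 • 1 - ‖b‖ ^ 2 • 1 := by abel
  rw [this, h]
  abel

theorem add_star_eq (a : F) : a + star a = (2 * inner ℝ 1 a : ℝ) • (1 : F) := by
  simpa using star_mul_add_star_mul 1 a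

theorem star_eq_smul_sub (a : F) : star a = (2 * inner ℝ 1 a : ℝ) • (1 : F) - a := by
  rw [← add_star_eq]; abel

theorem star_real_smul (r : ℝ) (a : F) : star (r • a) = r • star a := by
  rw [star_eq_smul_sub, star_eq_smul_sub a, inner_smul_right, smul_sub, smul_smul]
  congr 2
  ring

theorem inner_one_one : inner ℝ (1 : F) 1 = 1 := by
  rw [real_inner_self_eq_norm_sq, norm_one, one_pow]

theorem inner_star_star (a b : F) : inner ℝ (star a) (star b) = inner ℝ a b := by
  have h := norm_add_sq_real (star a) (star b)
  rw [← star_add, norm_star_eq, norm_star_eq, norm_star_eq, norm_add_sq_real] at h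
  linarith

theorem inner_mul_mul_left (a b c : F) : inner ℝ (a * b) (a * c) = ‖a‖ ^ 2 * inner ℝ b c := by
  have h := norm_add_sq_real (a * b) (a * c)
  rw [← mul_add, norm_mul, norm_mul, norm_mul, mul_pow, norm_add_sq_real] at h
  linarith

theorem inner_mul_mul_right (a b c : F) : inner ℝ (b * a) (c * a) = ‖a‖ ^ 2 * inner ℝ b c := by
  have h := norm_add_sq_real (b * a) (c * a)
  rw [← add_mul, norm_mul, norm_mul, norm_mul, mul_pow, norm_add_sq_real] at h
  linarith

theorem mul_star_self_eq (a : F) : a * star a = (‖a‖ ^ 2 : ℝ) • (1 : F) := by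
  simpa [norm_star_eq] using HyperbolicScalars.star_mul_self_eq (star a)

theorem inner_mul_left_eq (a b c : F) : inner ℝ (a * b) c = inner ℝ b (star a * c) := by
  rcases eq_or_ne a 0 with rfl | ha
  · simp
  have h := inner_mul_mul_left a b (star a * c)
  rw [← mul_assoc, mul_star_self_eq, smul_one_mul, inner_smul_right] at h
  exact mul_left_cancel₀ (pow_ne_zero 2 (norm_ne_zero_iff.2 ha)) h

theorem inner_mul_right_eq (a b c : F) : inner ℝ (a * b) c = inner ℝ a (c * star b) := by
  rcases eq_or_ne b 0 with rfl | hb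
  · simp
  have h := inner_mul_mul_right b a (c * star b)
  rw [mul_assoc, HyperbolicScalars.star_mul_self_eq, mul_smul_comm, mul_one,
    inner_smul_right] at h
  exact mul_left_cancel₀ (pow_ne_zero 2 (norm_ne_zero_iff.2 hb)) h

theorem inner_eq_inner_one (a b : F) : inner ℝ a b = inner ℝ 1 (star a * b) := by
  rw [← inner_mul_left_eq, mul_one]

end Scalars

/-! ### The Hermitian product -/

section HermProd

variable {F : Type} [NormedDivisionRing F] [StarRing F] [InnerProductSpace ℝ F]
  [HyperbolicScalars F] {k : ℕ}

/-- The scalar multiplication `X a` of the right vector space `Fᵏ`. -/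
def rmul (X : EuclideanSpace F (Fin k)) (a : F) : EuclideanSpace F (Fin k) :=
  WithLp.toLp 2 fun i => X i * a

theorem hermProd_add_left (p p' q : EuclideanSpace F (Fin k)) :
    hermProd (p + p') q = hermProd p q + hermProd p' q := by
  simp [hermProd, add_mul, Finset.sum_add_distrib]

theorem hermProd_add_right (p q q' : EuclideanSpace F (Fin k)) :
    hermProd p (q + q') = hermProd p q + hermProd p q' := by
  simp [hermProd, mul_add, Finset.sum_add_distrib]

theorem hermProd_smul_left (r : ℝ) (p q : EuclideanSpace F (Fin k)) :
    hermProd (r • p) q = r • hermProd p q := by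
  simp [hermProd, star_real_smul, Finset.smul_sum, smul_mul_assoc]

theorem hermProd_smul_right (r : ℝ) (p q : EuclideanSpace F (Fin k)) :
    hermProd p (r • q) = r • hermProd p q := by
  simp [hermProd, Finset.smul_sum, mul_smul_comm]

theorem hermProd_sub_left (p p' q : EuclideanSpace F (Fin k)) :
    hermProd (p - p') q = hermProd p q - hermProd p' q := by
  simp [hermProd, sub_mul, Finset.sum_sub_distrib]

theorem hermProd_sub_right (p q q' : EuclideanSpace F (Fin k)) :
    hermProd p (q - q') = hermProd p q - hermProd p q' := by
  simp [hermProd, mul_sub, Finset.sum_sub_distrib]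

theorem star_hermProd (p q : EuclideanSpace F (Fin k)) :
    star (hermProd p q) = hermProd q p := by
  simp [hermProd]

theorem hermProd_self (p : EuclideanSpace F (Fin k)) :
    hermProd p p = (‖p‖ ^ 2 : ℝ) • (1 : F) := by
  rw [PiLp.norm_sq_eq_of_L2, Finset.sum_smul]
  exact Finset.sum_congr rfl fun i _ => HyperbolicScalars.star_mul_self_eq _

theorem hermProd_rmul_right (p X : EuclideanSpace F (Fin k)) (a : F) :
    hermProd p (rmul X a) = hermProd p X * a := by
  simp [hermProd, rmul, Finset.sum_mul, mul_assoc]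

theorem hermProd_rmul_left (p X : EuclideanSpace F (Fin k)) (a : F) :
    hermProd (rmul X a) p = star a * hermProd X p := by
  simp [hermProd, rmul, Finset.mul_sum, mul_assoc]

theorem inner_eq_inner_one_hermProd (p q : EuclideanSpace F (Fin k)) :
    inner ℝ p q = inner ℝ 1 (hermProd p q) := by
  rw [hermProd, inner_sum, PiLp.inner_apply]
  exact Finset.sum_congr rfl fun i _ => inner_eq_inner_one _ _

theorem inner_rmul_left (X Y : EuclideanSpace F (Fin k)) (a : F) :
    inner ℝ (rmul X a) Y = inner ℝ a (hermProd X Y) := by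
  rw [inner_eq_inner_one_hermProd, hermProd_rmul_left, ← inner_eq_inner_one]

theorem norm_rmul (X : EuclideanSpace F (Fin k)) (a : F) : ‖rmul X a‖ = ‖X‖ * ‖a‖ := by
  rw [← sq_eq_sq₀ (norm_nonneg _) (by positivity), mul_pow, PiLp.norm_sq_eq_of_L2,
    PiLp.norm_sq_eq_of_L2, Finset.sum_mul]
  exact Finset.sum_congr rfl fun i _ => by simp [rmul, mul_pow]

theorem norm_hermProd_le (p q : EuclideanSpace F (Fin k)) : ‖hermProd p q‖ ≤ ‖p‖ * ‖q‖ := by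
  have h1 : ‖hermProd p q‖ ≤ ∑ i, ‖p i‖ * ‖q i‖ :=
    (norm_sum_le _ _).trans (Finset.sum_le_sum fun i _ => by rw [norm_mul, norm_star_eq])
  refine h1.trans ((Real.sum_mul_le_sqrt_mul_sqrt _ _ _).trans ?_)
  rw [PiLp.norm_eq_of_L2, PiLp.norm_eq_of_L2]

/-- The `F`-valued Hermitian product as a continuous real bilinear map. -/
noncomputable def hermProdL (F : Type) [NormedDivisionRing F] [StarRing F] [InnerProductSpace ℝ F]
    [HyperbolicScalars F] (k : ℕ) :
    EuclideanSpace F (Fin k) →L[ℝ] EuclideanSpace F (Fin k) →L[ℝ] F :=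
  LinearMap.mkContinuous₂
    (LinearMap.mk₂ ℝ hermProd hermProd_add_left hermProd_smul_left hermProd_add_right
      hermProd_smul_right) 1 fun p q => by
    simpa using norm_hermProd_le p q

@[simp]
theorem hermProdL_apply (p q : EuclideanSpace F (Fin k)) : hermProdL F k p q = hermProd p q := rfl

theorem one_sub_norm_sq_pos {p : EuclideanSpace F (Fin k)} (hp : p ∈ hypSpace F k) :
    0 < 1 - ‖p‖ ^ 2 := by
  have : ‖p‖ < 1 := by simpa [hypSpace] using hp
  nlinarith [norm_nonneg p]

theorem one_sub_hermProd_ne_zero {p q : EuclideanSpace F (Fin k)} (hp : p ∈ hypSpace F k)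
    (hq : q ∈ hypSpace F k) : 1 - hermProd p q ≠ 0 := by
  have hp' : ‖p‖ < 1 := by simpa [hypSpace] using hp
  have hq' : ‖q‖ < 1 := by simpa [hypSpace] using hq
  intro h
  have h1 : ‖hermProd p q‖ = 1 := by rw [← sub_eq_zero.1 h, norm_one]
  have := norm_hermProd_le p q
  nlinarith [norm_nonneg p, norm_nonneg q]

end HermProd

/-! ### The metric as a Hermitian form -/

section HypForm

variable {F : Type} [NormedDivisionRing F] [StarRing F] [InnerProductSpace ℝ F]
  [HyperbolicScalars F] {k : ℕ}

/-- The Hermitian form `⟨X, Y⟩ + ⟨X, p⟩⟨p, Y⟩ / (1 - |p|²)` on the tangent space at `p`. Up to the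
factor `1 - |p|²`, its real part is the hyperbolic metric; it is also the indefinite form of
`F^{k,1}` evaluated at the projections of `(X, 0)` and `(Y, 0)` to the complement of `(p, 1)`. -/
noncomputable def hypForm (p X Y : EuclideanSpace F (Fin k)) : F :=
  hermProd X Y + (1 - ‖p‖ ^ 2 : ℝ)⁻¹ • (hermProd X p * hermProd p Y)

/-- The square norm `hypForm p X X`, as a real number. -/
noncomputable def hypFormSq (p X : EuclideanSpace F (Fin k)) : ℝ :=
  ‖X‖ ^ 2 + (1 - ‖p‖ ^ 2)⁻¹ * ‖hermProd p X‖ ^ 2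

theorem hypForm_sub_left (p X X' Y : EuclideanSpace F (Fin k)) :
    hypForm p (X - X') Y = hypForm p X Y - hypForm p X' Y := by
  simp only [hypForm, hermProd_sub_left, sub_mul, smul_sub]; abel

theorem hypForm_smul_left (r : ℝ) (p X Y : EuclideanSpace F (Fin k)) :
    hypForm p (r • X) Y = r • hypForm p X Y := by
  simp only [hypForm, hermProd_smul_left, smul_mul_assoc, smul_add, smul_comm r]

theorem hypForm_rmul_left (p X Y : EuclideanSpace F (Fin k)) (a : F) :
    hypForm p (rmul X a) Y = star a * hypForm p X Y := by
  simp only [hypForm, hermProd_rmul_left, mul_add, mul_smul_comm, mul_assoc]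

/-- The Cauchy–Schwarz inequality for `hypForm`. -/
theorem norm_hypForm_sq_le {p : EuclideanSpace F (Fin k)} (hp : p ∈ hypSpace F k)
    (X Y : EuclideanSpace F (Fin k)) :
    ‖hypForm p X Y‖ ^ 2 ≤ hypFormSq p X * hypFormSq p Y := by
  have hm : 0 < (1 - ‖p‖ ^ 2)⁻¹ := inv_pos.2 (one_sub_norm_sq_pos hp)
  have h1 : ‖hypForm p X Y‖ ≤
      ‖X‖ * ‖Y‖ + (1 - ‖p‖ ^ 2)⁻¹ * (‖hermProd p X‖ * ‖hermProd p Y‖) := by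
    refine (norm_add_le _ _).trans (add_le_add (norm_hermProd_le X Y) ?_)
    rw [norm_smul, norm_mul, Real.norm_of_nonneg hm.le, ← star_hermProd p X, norm_star_eq]
  have h2 := pow_le_pow_left₀ (norm_nonneg _) h1 2
  refine h2.trans ?_
  unfold hypFormSq
  generalize (1 - ‖p‖ ^ 2)⁻¹ = s at *
  nlinarith [mul_nonneg hm.le (sq_nonneg (‖X‖ * ‖hermProd p Y‖ - ‖Y‖ * ‖hermProd p X‖))]

theorem hypFormSq_nonneg {p : EuclideanSpace F (Fin k)} (hp : p ∈ hypSpace F k)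
    (X : EuclideanSpace F (Fin k)) : 0 ≤ hypFormSq p X := by
  have hm : 0 < (1 - ‖p‖ ^ 2)⁻¹ := inv_pos.2 (one_sub_norm_sq_pos hp)
  unfold hypFormSq
  positivity

theorem hypFormSq_sub (p X Y : EuclideanSpace F (Fin k)) :
    hypFormSq p (X - Y) = hypFormSq p X - 2 * inner ℝ 1 (hypForm p X Y) + hypFormSq p Y := by
  rw [hypFormSq, hypFormSq, hypFormSq, hypForm, hermProd_sub_right, norm_sub_sq_real,
    norm_sub_sq_real, inner_add_right, inner_smul_right, ← inner_eq_inner_one_hermProd,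
    inner_eq_inner_one (hermProd p X), star_hermProd]
  ring

theorem hypFormSq_rmul (p X : EuclideanSpace F (Fin k)) (a : F) :
    hypFormSq p (rmul X a) = ‖a‖ ^ 2 * hypFormSq p X := by
  rw [hypFormSq, hypFormSq, norm_rmul, hermProd_rmul_right, norm_mul]
  ring

theorem hypFormSq_smul (p X : EuclideanSpace F (Fin k)) (r : ℝ) :
    hypFormSq p (r • X) = r ^ 2 * hypFormSq p X := by
  rw [hypFormSq, hypFormSq, norm_smul, hermProd_smul_right, norm_smul, mul_pow, mul_pow,
    Real.norm_eq_abs, sq_abs]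
  ring

theorem hermProd_left_sub (p q : EuclideanSpace F (Fin k)) :
    hermProd p (q - p) = (1 - ‖p‖ ^ 2 : ℝ) • (1 : F) - (1 - hermProd p q) := by
  rw [hermProd_sub_right, hermProd_self, sub_smul, one_smul]; abel

/-- The hyperbolic Pythagorean identity `sinh² d = cosh² d - 1`. -/
theorem hypFormSq_sub_self {p : EuclideanSpace F (Fin k)} (hp : p ∈ hypSpace F k)
    (q : EuclideanSpace F (Fin k)) :
    (1 - ‖p‖ ^ 2) * hypFormSq p (q - p) =
      ‖1 - hermProd p q‖ ^ 2 - (1 - ‖p‖ ^ 2) * (1 - ‖q‖ ^ 2) := by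
  have hm := (one_sub_norm_sq_pos hp).ne'
  rw [hypFormSq, hermProd_left_sub, norm_sub_sq_real, norm_sub_sq_real, norm_smul, norm_one,
    inner_smul_left, real_inner_comm, inner_eq_inner_one_hermProd p q, inner_sub_right,
    inner_one_one, mul_add, ← mul_assoc, mul_inv_cancel₀ hm, mul_one,
    Real.norm_eq_abs, sq_abs]
  simp only [Real.ringHom_apply]
  ring

end HypForm

/-! ### Convexity of `log cosh d` -/

section KeyInequality

variable {F : Type} [NormedDivisionRing F] [StarRing F] [InnerProductSpace ℝ F]
  [HyperbolicScalars F] {k : ℕ}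

theorem inner_star_mul_add (a b c : F) :
    inner ℝ b (star a * c) + inner ℝ c (star a * b) = 2 * inner ℝ 1 a * inner ℝ c b := by
  rw [← inner_mul_left_eq, real_inner_comm, ← inner_add_right, ← add_mul, add_star_eq,
    smul_one_mul, inner_smul_right]

theorem inner_mul_add (a b c : F) :
    inner ℝ b (c * a) + inner ℝ c (b * a) = 2 * inner ℝ 1 a * inner ℝ c b := by
  rw [real_inner_comm, inner_mul_right_eq, ← inner_add_right, add_comm, ← mul_add, add_star_eq,
    mul_smul_comm, mul_one, inner_smul_right]

/-- The second derivative of `log |c|` along a pair of geodesics, in affine lifts (left) and in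
lifts with horizontal velocity (right). Multiplying the two lifts by scalars with logarithmic
derivatives `s α` and `t β` turns the derivative `-(a + b)` of `c` into the gauged derivative. -/
theorem gauge_identity (a b z α β : F) {c : F} (hc : c ≠ 0) (s t : ℝ) :
    ‖-(a + b)‖ ^ 2 + inner ℝ c ((2 * s) • (star α * a) - (2 : ℝ) • z + (2 * t) • (b * β))
        - 2 * inner ℝ c (-(a + b)) ^ 2 / ‖c‖ ^ 2
        + ‖c‖ ^ 2 * (s ^ 2 * (‖α‖ ^ 2 - 2 * inner ℝ 1 α ^ 2)
          + t ^ 2 * (‖β‖ ^ 2 - 2 * inner ℝ 1 β ^ 2)) =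
      -2 * inner ℝ c (z + t • (a * β) + s • (star α * b) - (s * t) • (star α * (c * β)))
        + ‖-(a + b) + s • (star α * c) + t • (c * β)‖ ^ 2
        - 2 * inner ℝ c (-(a + b) + s • (star α * c) + t • (c * β)) ^ 2 / ‖c‖ ^ 2 := by
  have hc' : ‖c‖ ≠ 0 := norm_ne_zero_iff.2 hc
  have k1 : inner ℝ c (star α * c) = inner ℝ 1 α * ‖c‖ ^ 2 := by
    have := inner_star_mul_add α c c
    rw [real_inner_self_eq_norm_sq] at this
    linarith
  have k2 : inner ℝ c (c * β) = inner ℝ 1 β * ‖c‖ ^ 2 := by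
    have := inner_mul_add β c c
    rw [real_inner_self_eq_norm_sq] at this
    linarith
  have k4 := inner_star_mul_add α (-(a + b)) c
  have k5 := inner_mul_add β (-(a + b)) c
  have k6 := inner_star_mul_add α c (c * β)
  have k7 : ‖star α * c‖ = ‖α‖ * ‖c‖ := by rw [norm_mul, norm_star_eq]
  have k8 : ‖c * β‖ = ‖c‖ * ‖β‖ := norm_mul _ _
  have e1 : inner ℝ c (star α * (-(a + b))) =
      -inner ℝ c (star α * a) - inner ℝ c (star α * b) := by
    rw [mul_neg, mul_add, inner_neg_right, inner_add_right]; ring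
  have e2 : inner ℝ c ((-(a + b)) * β) = -inner ℝ c (a * β) - inner ℝ c (b * β) := by
    rw [neg_mul, add_mul, inner_neg_right, inner_add_right]; ring
  rw [e1] at k4
  rw [e2] at k5
  rw [real_inner_comm (star α * c), real_inner_comm c (c * β), k2] at k6
  generalize hd : -(a + b) = d at *
  rw [norm_add_sq_real, norm_add_sq_real, inner_add_left]
  simp only [inner_add_right, inner_sub_right, inner_smul_right, inner_smul_left, norm_smul, k1,
    k2, k7, k8, Real.ringHom_apply, mul_pow, Real.norm_eq_abs, sq_abs]
  field_simp
  linear_combination (-2 * s * ‖c‖ ^ 2) * k4 - 2 * t * ‖c‖ ^ 2 * k5 - 2 * s * t * ‖c‖ ^ 2 * k6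

theorem hypForm_sub_hermProd {p : EuclideanSpace F (Fin k)} (hp : p ∈ hypSpace F k)
    (q X : EuclideanSpace F (Fin k)) :
    hypForm p X (q - p) =
      hermProd X q - (1 - ‖p‖ ^ 2 : ℝ)⁻¹ • (hermProd X p * (1 - hermProd p q)) := by
  rw [hypForm, hermProd_left_sub, hermProd_sub_right, mul_sub, mul_smul_comm, mul_one, smul_sub,
    smul_smul, inv_mul_cancel₀ (one_sub_norm_sq_pos hp).ne', one_smul]
  abel

theorem hypForm_add_rmul_right (p X Y N : EuclideanSpace F (Fin k)) (b : F) :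
    hypForm p X (Y + rmul N b) = hypForm p X Y + hypForm p X N * b := by
  simp only [hypForm, hermProd_add_right, hermProd_rmul_right, mul_add, add_mul, smul_add,
    smul_mul_assoc, mul_assoc]
  abel

theorem star_hypForm (p X Y : EuclideanSpace F (Fin k)) :
    star (hypForm p X Y) = hypForm p Y X := by
  simp only [hypForm, star_add, star_real_smul, star_mul, star_hermProd]

theorem hypForm_self (p X : EuclideanSpace F (Fin k)) :
    hypForm p X X = hypFormSq p X • (1 : F) := by
  rw [hypForm, hypFormSq, add_smul, hermProd_self, ← star_hermProd p X,
    HyperbolicScalars.star_mul_self_eq, smul_smul]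

/-- Convexity of `log cosh d` on the product of two hyperbolic spaces: its second derivative along
the pair of geodesics through `p`, `q` with velocities `X`, `Y`, multiplied by `|c|²`, is
nonnegative. Here `c = 1 - ⟨p, q⟩`. -/
theorem logCosh_convexity {p q : EuclideanSpace F (Fin k)} (hp : p ∈ hypSpace F k)
    (hq : q ∈ hypSpace F k) (X Y : EuclideanSpace F (Fin k)) (s t : ℝ)
    (hs : s = (1 - ‖p‖ ^ 2)⁻¹) (ht : t = (1 - ‖q‖ ^ 2)⁻¹) :
    0 ≤ ‖-(hermProd X q + hermProd p Y)‖ ^ 2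
      + inner ℝ (1 - hermProd p q) ((2 * s) • (hermProd X p * hermProd X q)
          - (2 : ℝ) • hermProd X Y + (2 * t) • (hermProd p Y * hermProd q Y))
      - 2 * inner ℝ (1 - hermProd p q) (-(hermProd X q + hermProd p Y)) ^ 2
          / ‖1 - hermProd p q‖ ^ 2
      + ‖1 - hermProd p q‖ ^ 2 *
        (s ^ 2 * (‖hermProd p X‖ ^ 2 - 2 * inner ℝ 1 (hermProd p X) ^ 2)
          + t ^ 2 * (‖hermProd q Y‖ ^ 2 - 2 * inner ℝ 1 (hermProd q Y) ^ 2))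
      + ‖1 - hermProd p q‖ ^ 2 * (s * hypFormSq p X + t * hypFormSq q Y) := by
  have hc := one_sub_hermProd_ne_zero hp hq
  have hm := one_sub_norm_sq_pos hp
  have hμ := one_sub_norm_sq_pos hq
  have hN := hypFormSq_sub_self hp q
  rw [← star_hermProd p X, gauge_identity _ _ _ _ _ hc]
  -- `N`, `e` and `f` are the tangent vectors at `p` which represent the direction of `q`, the
  -- horizontal velocity at `q`, and the difference of the two velocities.
  set c := 1 - hermProd p q with hcdef
  set N := q - p with hNdef
  set β := hermProd q Y with hβdef
  set e := Y + rmul N (t • β) with he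
  set f := rmul X c - (1 - ‖p‖ ^ 2) • e with hf
  set w := hermProd X Y + t • (hermProd X q * β) + s • (star (hermProd p X) * hermProd p Y)
    - (s * t) • (star (hermProd p X) * (c * β)) with hw
  set d := -(hermProd X q + hermProd p Y) + s • (star (hermProd p X) * c) + t • (c * β) with hd
  have hXN : hypForm p X N = hermProd X q - s • (star (hermProd p X) * c) := by
    rw [hypForm_sub_hermProd hp, star_hermProd, hs]
  have hYN : hypForm p Y N = hermProd Y q - s • (hermProd Y p * c) := by
    rw [hypForm_sub_hermProd hp, hs]
  clear_value c N
  have hsm : s * (1 - ‖p‖ ^ 2) = 1 := by rw [hs]; exact inv_mul_cancel₀ hm.ne'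
  have htμ : t * (1 - ‖q‖ ^ 2) = 1 := by rw [ht]; exact inv_mul_cancel₀ hμ.ne'
  have hNY : hypForm p N Y = β - s • (star c * hermProd p Y) := by
    rw [← star_hypForm, hYN, star_sub, star_real_smul, star_mul, star_hermProd, star_hermProd]
  have hw' : w = hypForm p X e := by
    rw [he, hypForm_add_rmul_right, hXN, hypForm, ← star_hermProd p X, ← hs, hw]
    simp only [sub_mul, smul_mul_assoc, mul_smul_comm, smul_sub, smul_smul, mul_assoc,
      mul_comm t s]
    abel
  have hNe : (1 - ‖p‖ ^ 2) • hypForm p N e = -(star c * (hermProd p Y - t • (c * β))) := by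
    rw [he, hypForm_add_rmul_right, hNY, hypForm_self, smul_one_mul, smul_add, smul_sub, smul_smul,
      mul_comm _ s, hsm, one_smul, smul_smul, hN, smul_smul, mul_sub (star c), mul_smul_comm, ← mul_assoc,
      HyperbolicScalars.star_mul_self_eq, smul_one_mul, smul_smul]
    have : (‖c‖ ^ 2 - (1 - ‖p‖ ^ 2) * (1 - ‖q‖ ^ 2)) * t = t * ‖c‖ ^ 2 - (1 - ‖p‖ ^ 2) := by
      linear_combination -(1 - ‖p‖ ^ 2) * htμ
    rw [this]
    module
  have hcd : inner ℝ c d = -inner ℝ 1 (hypForm p f N) := by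
    have h1 : star c * d = -(star c * hypForm p X N) + (1 - ‖p‖ ^ 2) • hypForm p N e := by
      rw [hNe, hXN, hd]
      simp only [mul_add, mul_sub, mul_neg]
      abel
    have h2 : inner ℝ 1 (hypForm p N e) = inner ℝ 1 (hypForm p e N) := by
      rw [← star_hypForm, ← inner_star_star, star_one, star_star]
    rw [inner_eq_inner_one c d, h1, hf, hypForm_sub_left, hypForm_rmul_left, hypForm_smul_left,
      inner_add_right, inner_smul_right, h2, inner_sub_right, inner_smul_right, inner_neg_right]
    ring
  have hDd : inner ℝ c d ^ 2 ≤ ‖c‖ ^ 2 * ‖d‖ ^ 2 := by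
    rw [← mul_pow, ← sq_abs]
    exact pow_le_pow_left₀ (abs_nonneg _) (abs_real_inner_le_norm c d) 2
  have hDf : inner ℝ c d ^ 2 ≤ hypFormSq p f * hypFormSq p N := by
    refine le_trans ?_ (norm_hypForm_sq_le hp f N)
    rw [hcd, neg_sq, ← sq_abs]
    refine pow_le_pow_left₀ (abs_nonneg _) ((abs_real_inner_le_norm _ _).trans ?_) 2
    rw [norm_one, one_mul]
  have hff : hypFormSq p f = ‖c‖ ^ 2 * hypFormSq p X - 2 * (1 - ‖p‖ ^ 2) * inner ℝ c w
      + (1 - ‖p‖ ^ 2) ^ 2 * hypFormSq p e := by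
    have : hypForm p (rmul X c) ((1 - ‖p‖ ^ 2) • e) = (1 - ‖p‖ ^ 2) • (star c * w) := by
      rw [← star_hypForm, hypForm_smul_left, star_real_smul, star_hypForm, hypForm_rmul_left, hw']
    rw [hf, hypFormSq_sub, hypFormSq_rmul, hypFormSq_smul, this, inner_smul_right,
      ← inner_eq_inner_one]
    ring
  have hNN : hypFormSq p N = s * ‖c‖ ^ 2 - (1 - ‖q‖ ^ 2) := by
    linear_combination s * hN - (hypFormSq p N + (1 - ‖q‖ ^ 2)) * hsm
  have hee : hypFormSq p e =
      hypFormSq q Y + s * ‖hermProd p Y - t • (c * β)‖ ^ 2 := by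
    have h1 : e = Y - rmul N (-(t • β)) := by
      ext i; simp [he, rmul]
    have h2 : hypForm p Y (rmul N (-(t • β))) =
        -(t • (star β * β)) + (s * t) • (star (hermProd p Y) * (c * β)) := by
      rw [← zero_add (rmul N _), hypForm_add_rmul_right, hYN, ← star_hermProd q Y,
        ← star_hermProd p Y]
      have : hypForm p Y 0 = 0 := by simp [hypForm, hermProd]
      rw [this]
      simp only [mul_neg, mul_smul_comm, sub_mul, smul_sub, smul_mul_assoc, mul_assoc, smul_smul,
        mul_comm t s, neg_sub, zero_add]
      abel
    rw [h1, hypFormSq_sub, h2, hypFormSq_rmul, hNN, inner_add_right, inner_neg_right,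
      inner_smul_right, inner_smul_right, ← inner_eq_inner_one, ← inner_eq_inner_one,
      real_inner_self_eq_norm_sq, norm_neg, norm_smul, norm_sub_sq_real, norm_smul, norm_mul,
      inner_smul_right, hypFormSq, hypFormSq, ← hs, ← ht]
    simp only [mul_pow, Real.norm_eq_abs, sq_abs]
    linear_combination (-t * ‖β‖ ^ 2) * htμ
  have hbN : ‖c‖ ^ 2 * ‖hermProd p Y - t • (c * β)‖ ^ 2 ≤
      (1 - ‖p‖ ^ 2) ^ 2 * (hypFormSq p N * hypFormSq p e) := by
    have h1 := congrArg (fun x => ‖x‖ ^ 2) hNe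
    simp only [norm_smul, norm_neg, norm_mul, norm_star_eq, mul_pow, Real.norm_eq_abs, sq_abs] at h1
    rw [← h1]
    exact mul_le_mul_of_nonneg_left (norm_hypForm_sq_le hp N e) (sq_nonneg _)
  have hC : 0 < ‖c‖ ^ 2 := pow_pos (norm_pos_iff.2 hc) 2
  have hs0 : 0 < s := hs ▸ inv_pos.2 hm
  have ht0 : 0 < t := ht ▸ inv_pos.2 hμ
  have hf0 := hypFormSq_nonneg hp f
  have he0 := hypFormSq_nonneg hp e
  -- `h1` and `h2` reduce the claim to `h4`, the Cauchy–Schwarz inequality for `N` and `e`.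
  have h1 : inner ℝ c d ^ 2 / ‖c‖ ^ 2 ≤ ‖d‖ ^ 2 := by
    rw [div_le_iff₀ hC]; linarith
  have h2 : inner ℝ c d ^ 2 / ‖c‖ ^ 2 ≤ s * hypFormSq p f := by
    rw [div_le_iff₀ hC]
    refine hDf.trans ?_
    rw [hNN]
    nlinarith
  have h3 : s * hypFormSq p f = s * ‖c‖ ^ 2 * hypFormSq p X - 2 * inner ℝ c w
      + (1 - ‖p‖ ^ 2) * hypFormSq p e := by
    rw [hff]
    linear_combination (-2 * inner ℝ c w + (1 - ‖p‖ ^ 2) * hypFormSq p e) * hsm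
  have h4 : s * t * (‖c‖ ^ 2 * ‖hermProd p Y - t • (c * β)‖ ^ 2) ≤
      (t * ‖c‖ ^ 2 - (1 - ‖p‖ ^ 2)) * hypFormSq p e := by
    refine (mul_le_mul_of_nonneg_left hbN (by positivity)).trans_eq ?_
    rw [hNN]
    have e1 : s * (1 - ‖p‖ ^ 2) ^ 2 * s = 1 := by
      linear_combination (s * (1 - ‖p‖ ^ 2) + 1) * hsm
    linear_combination (t * ‖c‖ ^ 2 * hypFormSq p e) * e1
      - (1 - ‖p‖ ^ 2) * (t * (1 - ‖q‖ ^ 2)) * hypFormSq p e * hsm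
      - (1 - ‖p‖ ^ 2) * hypFormSq p e * htμ
  have h5 : t * ‖c‖ ^ 2 * hypFormSq q Y = t * ‖c‖ ^ 2 * hypFormSq p e
      - s * t * (‖c‖ ^ 2 * ‖hermProd p Y - t • (c * β)‖ ^ 2) := by
    rw [hee]; ring
  have h6 : 2 * inner ℝ c d ^ 2 / ‖c‖ ^ 2 =
      inner ℝ c d ^ 2 / ‖c‖ ^ 2 + inner ℝ c d ^ 2 / ‖c‖ ^ 2 := by ring
  rw [h6]
  linarith

end KeyInequality

/-! ### The harmonic map equation -/

section Christoffel

variable {F : Type} [NormedDivisionRing F] [StarRing F] [InnerProductSpace ℝ F]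
  [HyperbolicScalars F] {k : ℕ}

theorem fderiv_hypMetric {p : EuclideanSpace F (Fin k)} (hp : p ∈ hypSpace F k)
    (V Y Z : EuclideanSpace F (Fin k)) :
    fderiv ℝ (fun q => hypMetric q Y Z) p V =
      2 * inner ℝ p V * inner ℝ Y Z / (1 - ‖p‖ ^ 2) ^ 2
      + 4 * inner ℝ p V * inner ℝ (hermProd p Y) (hermProd p Z) / (1 - ‖p‖ ^ 2) ^ 3
      + (inner ℝ (hermProd V Y) (hermProd p Z) + inner ℝ (hermProd p Y) (hermProd V Z))
        / (1 - ‖p‖ ^ 2) ^ 2 := by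
  have hm := (one_sub_norm_sq_pos hp).ne'
  have hL : ∀ W : EuclideanSpace F (Fin k),
      HasFDerivAt (fun q => hermProd q W) ((hermProdL F k).flip W) p := fun W =>
    ((hermProdL F k).flip W).hasFDerivAt
  have h1 : HasFDerivAt (fun q : EuclideanSpace F (Fin k) => 1 - ‖q‖ ^ 2)
      (-(2 • innerSL ℝ p)) p := (hasStrictFDerivAt_norm_sq p).hasFDerivAt.const_sub 1
  have h2 := ((h1.mul_const (inner ℝ Y Z)).add ((hL Y).inner ℝ (hL Z))).mul
    ((hasDerivAt_inv (pow_ne_zero 2 hm)).comp_hasFDerivAt p (h1.pow 2))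
  have h3 : HasFDerivAt (fun q => hypMetric q Y Z) _ p := h2
  rw [h3.fderiv]
  simp
  field_simp
  ring

theorem inner_one_mul_self (a : F) : inner ℝ 1 (a * a) = 2 * inner ℝ 1 a ^ 2 - ‖a‖ ^ 2 := by
  rw [← star_star a, ← inner_mul_left_eq, mul_one, star_star,
    star_eq_smul_sub, inner_sub_left, inner_smul_left, real_inner_self_eq_norm_sq,
    Real.ringHom_apply]
  ring

theorem hypMetric_add_left (p X X' Z : EuclideanSpace F (Fin k)) :
    hypMetric p (X + X') Z = hypMetric p X Z + hypMetric p X' Z := by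
  simp only [hypMetric, hermProd_add_right, inner_add_left]; ring

/-- In the projective ball model the Christoffel symbols satisfy
`Γ(X, X) = 2 X ⟨p, X⟩ / (1 - |p|²)`. -/
theorem hypChristoffel_self {p : EuclideanSpace F (Fin k)} (hp : p ∈ hypSpace F k)
    (X Z : EuclideanSpace F (Fin k)) :
    hypChristoffel p X X Z =
      hypMetric p ((2 / (1 - ‖p‖ ^ 2)) • rmul X (hermProd p X)) Z := by
  have hm := (one_sub_norm_sq_pos hp).ne'
  rw [hypChristoffel, fderiv_hypMetric hp, fderiv_hypMetric hp, hypMetric, hermProd_smul_right,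
    hermProd_rmul_right, inner_smul_left, inner_smul_left, inner_rmul_left, hermProd_self,
    inner_smul_left, real_inner_self_eq_norm_sq, real_inner_self_eq_norm_sq,
    inner_eq_inner_one_hermProd p X, inner_eq_inner_one_hermProd p Z,
    inner_eq_inner_one_hermProd X Z, ← star_hermProd X Z]
  generalize hermProd p X = α
  generalize hermProd p Z = ζ
  generalize hermProd X Z = σ
  -- The two identities below say that `α + star α` is real.
  have h1 : inner ℝ (α * α) ζ = 2 * inner ℝ 1 α * inner ℝ α ζ - ‖α‖ ^ 2 * inner ℝ 1 ζ := by
    have h := inner_mul_left_eq α α ζ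
    rw [star_eq_smul_sub, sub_mul, smul_one_mul, inner_sub_right, inner_smul_right] at h
    have h' := inner_mul_mul_left α 1 ζ
    rw [mul_one] at h'
    rw [h, h']
  have h2 : inner ℝ α (star σ) = 2 * inner ℝ 1 σ * inner ℝ 1 α - inner ℝ α σ := by
    rw [star_eq_smul_sub, inner_sub_right, inner_smul_right, real_inner_comm α 1]
  rw [h1, real_inner_comm α (star σ), h2]
  simp only [Real.ringHom_apply]
  field_simp
  ring

/-- The hyperbolic metric is definite. -/
theorem hypMetric_self_eq_zero {p : EuclideanSpace F (Fin k)} (hp : p ∈ hypSpace F k)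
    {X : EuclideanSpace F (Fin k)} (h : hypMetric p X X = 0) : X = 0 := by
  have hm := one_sub_norm_sq_pos hp
  rw [hypMetric, div_eq_zero_iff, real_inner_self_eq_norm_sq, real_inner_self_eq_norm_sq] at h
  rcases h with h | h
  · have : ‖X‖ ^ 2 = 0 := by
      have h1 : 0 ≤ ‖X‖ ^ 2 := sq_nonneg _
      have h2 : 0 ≤ ‖hermProd p X‖ ^ 2 := sq_nonneg _
      nlinarith [mul_nonneg hm.le h1]
    simpa using this
  · exact absurd h (pow_ne_zero 2 hm.ne')

/-- The map `φ` satisfies at `x` the harmonic map equation solved for the Laplacian. -/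
def HarmonicEqAt {n : ℕ} (φ : EuclideanSpace ℝ (Fin n) → EuclideanSpace F (Fin k))
    (x : EuclideanSpace ℝ (Fin n)) : Prop :=
  Δ φ x = ∑ i, -((2 / (1 - ‖φ x‖ ^ 2)) •
    rmul (partialDeriv φ i x) (hermProd (φ x) (partialDeriv φ i x)))

theorem IsHarmonicMap.harmonicEqAt {n : ℕ} {Ω S : Set (EuclideanSpace ℝ (Fin n))}
    {φ : EuclideanSpace ℝ (Fin n) → EuclideanSpace F (Fin k)} (h : IsHarmonicMap Ω S φ)
    {x : EuclideanSpace ℝ (Fin n)} (hx : x ∈ Ω \ S) : HarmonicEqAt φ x := by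
  have hp : φ x ∈ hypSpace F k := h.mapsTo ⟨subset_closure hx.1, hx.2⟩
  have hsum : ∀ (v : Fin n → EuclideanSpace F (Fin k)) (Z : EuclideanSpace F (Fin k)),
      ∑ i, hypMetric (φ x) (v i) Z = hypMetric (φ x) (∑ i, v i) Z := fun v Z =>
    (map_sum (AddMonoidHom.mk' (fun X => hypMetric (φ x) X Z)
      fun X X' => hypMetric_add_left (φ x) X X' Z) v Finset.univ).symm
  have key : Δ φ x + ∑ i, (2 / (1 - ‖φ x‖ ^ 2)) •
      rmul (partialDeriv φ i x) (hermProd (φ x) (partialDeriv φ i x)) = 0 := by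
    apply hypMetric_self_eq_zero hp
    have := h.harmonic x hx (Δ φ x + ∑ i, (2 / (1 - ‖φ x‖ ^ 2)) •
      rmul (partialDeriv φ i x) (hermProd (φ x) (partialDeriv φ i x)))
    rwa [Finset.sum_congr rfl fun i _ => hypChristoffel_self hp _ _, hsum,
      ← hypMetric_add_left] at this
  rw [HarmonicEqAt, Finset.sum_neg_distrib]
  exact eq_neg_of_add_eq_zero_left key

theorem harmonicEqAt_const {n : ℕ} (p : EuclideanSpace F (Fin k))
    (x : EuclideanSpace ℝ (Fin n)) : HarmonicEqAt (fun _ => p) x := by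
  have h : ∀ i : Fin n, partialDeriv (fun _ => p) i x = 0 := fun i => by simp [partialDeriv]
  have h0 : rmul (0 : EuclideanSpace F (Fin k)) (hermProd p 0) = 0 := by ext; simp [rmul]
  simp [HarmonicEqAt, h, h0, InnerProductSpace.laplacian_const]

end Christoffel

/-! ### Second derivatives along lines -/

section SecondDeriv

variable {E G H : Type*} [NormedAddCommGroup E] [NormedSpace ℝ E] [NormedAddCommGroup G]
  [NormedSpace ℝ G] [NormedAddCommGroup H] [NormedSpace ℝ H]

/-- The curve `f` is differentiable near `t`, with `f' t = f₁`, and `f'' t = f₂`. -/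
def HasSecondDerivAt (f : ℝ → E) (f₁ f₂ : E) (t : ℝ) : Prop :=
  ∃ f' : ℝ → E, (∀ᶠ s in 𝓝 t, HasDerivAt f (f' s) s) ∧ f' t = f₁ ∧ HasDerivAt f' f₂ t

namespace HasSecondDerivAt

variable {f : ℝ → E} {f₁ f₂ : E} {t : ℝ}

theorem hasDerivAt (hf : HasSecondDerivAt f f₁ f₂ t) : HasDerivAt f f₁ t := by
  obtain ⟨f', h, rfl, -⟩ := hf
  exact h.self_of_nhds

theorem unique {f₁' f₂' : E} (hf : HasSecondDerivAt f f₁ f₂ t)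
    (hf' : HasSecondDerivAt f f₁' f₂' t) : f₂ = f₂' := by
  obtain ⟨g, hg, -, hg2⟩ := hf
  obtain ⟨g', hg', -, hg2'⟩ := hf'
  refine hg2.unique (hg2'.congr_of_eventuallyEq ?_)
  filter_upwards [hg, hg'] with s h h' using h.unique h'

theorem congr {g₁ g₂ : E} (hf : HasSecondDerivAt f f₁ f₂ t) (h₁ : f₁ = g₁) (h₂ : f₂ = g₂) :
    HasSecondDerivAt f g₁ g₂ t := h₁ ▸ h₂ ▸ hf

theorem const (c : E) (t : ℝ) : HasSecondDerivAt (fun _ => c) 0 0 t :=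
  ⟨fun _ => 0, .of_forall fun s => hasDerivAt_const s c, rfl, hasDerivAt_const t 0⟩

theorem add {g : ℝ → E} {g₁ g₂ : E} (hf : HasSecondDerivAt f f₁ f₂ t)
    (hg : HasSecondDerivAt g g₁ g₂ t) :
    HasSecondDerivAt (fun s => f s + g s) (f₁ + g₁) (f₂ + g₂) t := by
  obtain ⟨f', h, rfl, h2⟩ := hf
  obtain ⟨g', h', rfl, h2'⟩ := hg
  exact ⟨fun s => f' s + g' s, by filter_upwards [h, h'] with s a b using a.add b, rfl, h2.add h2'⟩

theorem clm (L : E →L[ℝ] G) (hf : HasSecondDerivAt f f₁ f₂ t) :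
    HasSecondDerivAt (fun s => L (f s)) (L f₁) (L f₂) t := by
  obtain ⟨f', h, rfl, h2⟩ := hf
  exact ⟨fun s => L (f' s), by
    filter_upwards [h] with s a using L.hasFDerivAt.comp_hasDerivAt s a, rfl,
    L.hasFDerivAt.comp_hasDerivAt t h2⟩

theorem neg (hf : HasSecondDerivAt f f₁ f₂ t) :
    HasSecondDerivAt (fun s => -f s) (-f₁) (-f₂) t := by
  simpa using hf.clm (-(ContinuousLinearMap.id ℝ E))

theorem sub {g : ℝ → E} {g₁ g₂ : E} (hf : HasSecondDerivAt f f₁ f₂ t)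
    (hg : HasSecondDerivAt g g₁ g₂ t) :
    HasSecondDerivAt (fun s => f s - g s) (f₁ - g₁) (f₂ - g₂) t := by
  simpa only [sub_eq_add_neg] using hf.add hg.neg

theorem const_mul {f : ℝ → ℝ} {f₁ f₂ : ℝ} (c : ℝ) (hf : HasSecondDerivAt f f₁ f₂ t) :
    HasSecondDerivAt (fun s => c * f s) (c * f₁) (c * f₂) t := by
  simpa using hf.clm (c • (ContinuousLinearMap.id ℝ ℝ))

/-- The Leibniz rule for a bilinear map. -/
theorem bilin (B : E →L[ℝ] G →L[ℝ] H) {g : ℝ → G} {g₁ g₂ : G} (hf : HasSecondDerivAt f f₁ f₂ t)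
    (hg : HasSecondDerivAt g g₁ g₂ t) :
    HasSecondDerivAt (fun s => B (f s) (g s)) (B f₁ (g t) + B (f t) g₁)
      (B f₂ (g t) + (2 : ℝ) • B f₁ g₁ + B (f t) g₂) t := by
  have hfd := hf.hasDerivAt
  have hgd := hg.hasDerivAt
  obtain ⟨f', h, rfl, h2⟩ := hf
  obtain ⟨g', h', rfl, h2'⟩ := hg
  refine ⟨fun s => B (f' s) (g s) + B (f s) (g' s), ?_, rfl, ?_⟩
  · filter_upwards [h, h'] with s a b
    rw [add_comm]
    exact B.hasDerivAt_of_bilinear (fun _ => a) (fun _ => b)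
  · have := (B.hasDerivAt_of_bilinear (fun _ => h2) (fun _ => hgd)).add
      (B.hasDerivAt_of_bilinear (fun _ => hfd) (fun _ => h2'))
    refine this.congr_deriv ?_
    module

theorem inner_self {V : Type*} [NormedAddCommGroup V] [InnerProductSpace ℝ V] {f : ℝ → V}
    {f₁ f₂ : V} (hf : HasSecondDerivAt f f₁ f₂ t) :
    HasSecondDerivAt (fun s => ‖f s‖ ^ 2) (2 * inner ℝ (f t) f₁)
      (2 * ‖f₁‖ ^ 2 + 2 * inner ℝ (f t) f₂) t := by
  have h : HasSecondDerivAt (fun s => inner ℝ (f s) (f s)) (inner ℝ f₁ (f t) + inner ℝ (f t) f₁)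
      (inner ℝ f₂ (f t) + (2 : ℝ) • inner ℝ f₁ f₁ + inner ℝ (f t) f₂) t := hf.bilin (innerSL ℝ) hf
  simp only [real_inner_self_eq_norm_sq] at h
  refine h.congr ?_ ?_
  · rw [real_inner_comm]; ring
  · rw [real_inner_comm, smul_eq_mul]; ring

theorem comp {f : ℝ → ℝ} {f₁ f₂ : ℝ} {g : ℝ → ℝ} {g₁ g₂ : ℝ}
    (hg : HasSecondDerivAt g g₁ g₂ (f t)) (hf : HasSecondDerivAt f f₁ f₂ t) :
    HasSecondDerivAt (fun s => g (f s)) (g₁ * f₁) (g₂ * f₁ ^ 2 + g₁ * f₂) t := by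
  have hfd := hf.hasDerivAt
  obtain ⟨f', h, rfl, h2⟩ := hf
  obtain ⟨g', h', rfl, h2'⟩ := hg
  refine ⟨fun s => g' (f s) * f' s, ?_, rfl, ?_⟩
  · filter_upwards [h, hfd.continuousAt.eventually h'] with s a b using b.comp s a
  · have := (h2'.comp t hfd).mul h2
    exact this.congr_deriv (by simp only [Function.comp_apply]; ring)

theorem log {f : ℝ → ℝ} {f₁ f₂ : ℝ} (hf : HasSecondDerivAt f f₁ f₂ t) (h0 : f t ≠ 0) :
    HasSecondDerivAt (fun s => Real.log (f s)) (f₁ / f t) (f₂ / f t - f₁ ^ 2 / f t ^ 2) t := by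
  have hlog : HasSecondDerivAt Real.log (f t)⁻¹ (-(f t ^ 2)⁻¹) (f t) :=
    ⟨fun s => s⁻¹, by filter_upwards [isOpen_ne.mem_nhds h0] with s hs using Real.hasDerivAt_log hs,
      rfl, hasDerivAt_inv h0⟩
  refine (hlog.comp hf).congr ?_ ?_
  · field_simp
  · field_simp; ring

/-- The necessary second order condition at a local maximum. -/
theorem nonpos_of_isLocalMax {f : ℝ → ℝ} {f₁ f₂ : ℝ} (hf : HasSecondDerivAt f f₁ f₂ t)
    (h : IsLocalMax f t) : f₂ ≤ 0 := by
  have hfd := hf.hasDerivAt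
  obtain ⟨f', h', rfl, h2⟩ := hf
  by_contra! hpos
  have hd : deriv f =ᶠ[𝓝 t] f' := by filter_upwards [h'] with s hs using hs.deriv
  have hdd : deriv (deriv f) t = f₂ := (h2.congr_of_eventuallyEq hd).deriv
  -- With a positive second derivative `f` would also have a local minimum at `t`, hence be constant.
  have hmin := isLocalMin_of_deriv_deriv_pos (by rwa [hdd]) h.deriv_eq_zero hfd.continuousAt
  have hc : f =ᶠ[𝓝 t] fun _ => f t := by
    filter_upwards [h, hmin] with s a b using le_antisymm a b
  have h0 : deriv f =ᶠ[𝓝 t] fun _ => 0 := by simpa using hc.deriv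
  rw [h0.deriv_eq, deriv_const] at hdd
  exact hpos.ne hdd

end HasSecondDerivAt

theorem ContDiffAt.hasSecondDerivAt_line {f : E → G} {x : E} (hf : ContDiffAt ℝ 2 f x) (v : E) :
    HasSecondDerivAt (fun t : ℝ => f (x + t • v)) (fderiv ℝ f x v)
      (iteratedFDeriv ℝ 2 f x ![v, v]) 0 := by
  have hline : ∀ t : ℝ, HasDerivAt (fun t : ℝ => x + t • v) v t := fun t => by
    simpa using ((hasDerivAt_id t).smul_const v).const_add x
  have hx : x + (0 : ℝ) • v = x := by simp
  have hev : ∀ᶠ y in 𝓝 x, DifferentiableAt ℝ f y := by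
    filter_upwards [hf.eventually (by simp)] with y hy using hy.differentiableAt (by simp)
  refine ⟨fun t => fderiv ℝ f (x + t • v) v, ?_, by simp, ?_⟩
  · have ht : Filter.Tendsto (fun t : ℝ => x + t • v) (𝓝 0) (𝓝 x) := by
      simpa using (hline 0).continuousAt.tendsto
    filter_upwards [ht.eventually hev] with t h
    exact h.hasFDerivAt.comp_hasDerivAt t (hline t)
  · have h2 : HasFDerivAt (fderiv ℝ f) (fderiv ℝ (fderiv ℝ f) x) (x + (0 : ℝ) • v) := by
      rw [hx]
      exact ((hf.fderiv_right (m := 1) (by norm_num)).differentiableAt (by simp)).hasFDerivAt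
    have := (ContinuousLinearMap.apply ℝ G v).hasFDerivAt.comp_hasDerivAt (0 : ℝ)
      (h2.comp_hasDerivAt (0 : ℝ) (hline 0))
    rw [iteratedFDeriv_two_apply]
    exact this

theorem laplacian_eq_sum_iteratedFDeriv {n : ℕ} (f : EuclideanSpace ℝ (Fin n) → G)
    (x : EuclideanSpace ℝ (Fin n)) :
    Δ f x = ∑ i, iteratedFDeriv ℝ 2 f x
      ![EuclideanSpace.single i 1, EuclideanSpace.single i 1] := by
  rw [InnerProductSpace.laplacian_eq_iteratedFDeriv_orthonormalBasis f
    (EuclideanSpace.basisFun (Fin n) ℝ)]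
  simp

/-- The Laplacian as the sum of the second derivatives along the coordinate lines. -/
theorem laplacian_eq_sum_of_hasSecondDerivAt {n : ℕ} {f : EuclideanSpace ℝ (Fin n) → G}
    {x : EuclideanSpace ℝ (Fin n)} (hf : ContDiffAt ℝ 2 f x) {a b : Fin n → G}
    (h : ∀ i, HasSecondDerivAt (fun t : ℝ => f (x + t • EuclideanSpace.single i 1))
      (a i) (b i) 0) : Δ f x = ∑ i, b i := by
  rw [laplacian_eq_sum_iteratedFDeriv]
  exact Finset.sum_congr rfl fun i _ => (hf.hasSecondDerivAt_line _).unique (h i)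

theorem IsLocalMax.laplacian_nonpos {n : ℕ} {f : EuclideanSpace ℝ (Fin n) → ℝ}
    {x : EuclideanSpace ℝ (Fin n)} (h : IsLocalMax f x) (hf : ContDiffAt ℝ 2 f x) :
    Δ f x ≤ 0 := by
  rw [laplacian_eq_sum_iteratedFDeriv]
  refine Finset.sum_nonpos fun i _ => (hf.hasSecondDerivAt_line _).nonpos_of_isLocalMax ?_
  have hx : x + (0 : ℝ) • EuclideanSpace.single i 1 = x := by simp
  have ht : Filter.Tendsto (fun t : ℝ => x + t • EuclideanSpace.single i (1 : ℝ)) (𝓝 0) (𝓝 x) := by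
    have : Continuous fun t : ℝ => x + t • EuclideanSpace.single i (1 : ℝ) := by fun_prop
    simpa using this.tendsto 0
  filter_upwards [ht.eventually h] with t h'
  rwa [hx]

end SecondDeriv

/-! ### The function `log cosh d` -/

section LogCosh

variable {F : Type} [NormedDivisionRing F] [StarRing F] [InnerProductSpace ℝ F]
  [HyperbolicScalars F] {k : ℕ}

/-- The logarithm of the hyperbolic cosine of the hyperbolic distance. Unlike the distance it is
smooth on the diagonal, and it differs from the distance by at most `log 2`. -/
noncomputable def logCosh (p q : EuclideanSpace F (Fin k)) : ℝ :=
  (Real.log (‖1 - hermProd p q‖ ^ 2) - Real.log (1 - ‖p‖ ^ 2) - Real.log (1 - ‖q‖ ^ 2)) / 2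

theorem logCosh_comm (p q : EuclideanSpace F (Fin k)) : logCosh p q = logCosh q p := by
  have : ‖1 - hermProd p q‖ = ‖1 - hermProd q p‖ := by
    rw [← norm_star_eq, star_sub, star_one, star_hermProd]
  rw [logCosh, logCosh, this]
  ring

theorem one_sub_mul_le {p q : EuclideanSpace F (Fin k)} (hp : p ∈ hypSpace F k) :
    (1 - ‖p‖ ^ 2) * (1 - ‖q‖ ^ 2) ≤ ‖1 - hermProd p q‖ ^ 2 := by
  have h := hypFormSq_sub_self hp q
  have := mul_nonneg (one_sub_norm_sq_pos hp).le (hypFormSq_nonneg hp (q - p))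
  linarith

theorem logCosh_self (p : EuclideanSpace F (Fin k)) : logCosh p p = 0 := by
  have h : 1 - hermProd p p = (1 - ‖p‖ ^ 2 : ℝ) • (1 : F) := by
    rw [hermProd_self, sub_smul, one_smul]
  rw [logCosh, h, norm_smul, norm_one, mul_one, Real.norm_eq_abs, sq_abs, Real.log_pow]
  push_cast
  ring

/-- The argument of `arcosh` in the definition of the distance is `exp (logCosh p q)`. -/
theorem exp_logCosh {p q : EuclideanSpace F (Fin k)} (hp : p ∈ hypSpace F k)
    (hq : q ∈ hypSpace F k) :
    Real.exp (logCosh p q) =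
      ‖1 - hermProd p q‖ / Real.sqrt ((1 - ‖p‖ ^ 2) * (1 - ‖q‖ ^ 2)) := by
  have hm := one_sub_norm_sq_pos hp
  have hμ := one_sub_norm_sq_pos hq
  have hc := norm_pos_iff.2 (one_sub_hermProd_ne_zero hp hq)
  have h : logCosh p q = Real.log (‖1 - hermProd p q‖ /
      Real.sqrt ((1 - ‖p‖ ^ 2) * (1 - ‖q‖ ^ 2))) := by
    rw [Real.log_div hc.ne' (Real.sqrt_pos.2 (mul_pos hm hμ)).ne', Real.log_sqrt (by positivity),
      Real.log_mul hm.ne' hμ.ne', logCosh, Real.log_pow]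
    push_cast
    ring
  rw [h, Real.exp_log (div_pos hc (Real.sqrt_pos.2 (mul_pos hm hμ)))]

theorem logCosh_nonneg {p q : EuclideanSpace F (Fin k)} (hp : p ∈ hypSpace F k)
    (hq : q ∈ hypSpace F k) : 0 ≤ logCosh p q := by
  have hm := one_sub_norm_sq_pos hp
  have hμ := one_sub_norm_sq_pos hq
  have h := Real.log_le_log (mul_pos hm hμ) (one_sub_mul_le (q := q) hp)
  rw [Real.log_mul hm.ne' hμ.ne'] at h
  unfold logCosh
  linarith

theorem cosh_hypDist {p q : EuclideanSpace F (Fin k)} (hp : p ∈ hypSpace F k)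
    (hq : q ∈ hypSpace F k) : Real.cosh (hypDist p q) = Real.exp (logCosh p q) := by
  rw [hypDist, ← exp_logCosh hp hq, Real.cosh_arcosh (Real.one_le_exp (logCosh_nonneg hp hq))]

theorem hypDist_nonneg {p q : EuclideanSpace F (Fin k)} (hp : p ∈ hypSpace F k)
    (hq : q ∈ hypSpace F k) : 0 ≤ hypDist p q := by
  rw [hypDist, ← exp_logCosh hp hq]
  exact Real.arcosh_nonneg (Real.one_le_exp (logCosh_nonneg hp hq))

theorem logCosh_le_hypDist {p q : EuclideanSpace F (Fin k)} (hp : p ∈ hypSpace F k)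
    (hq : q ∈ hypSpace F k) : logCosh p q ≤ hypDist p q := by
  have h0 := hypDist_nonneg hp hq
  rw [← Real.exp_le_exp, ← cosh_hypDist hp hq, Real.cosh_eq]
  have : Real.exp (-hypDist p q) ≤ Real.exp (hypDist p q) := Real.exp_le_exp.2 (by linarith)
  linarith

theorem hypDist_le_logCosh_add {p q : EuclideanSpace F (Fin k)} (hp : p ∈ hypSpace F k)
    (hq : q ∈ hypSpace F k) : hypDist p q ≤ logCosh p q + Real.log 2 := by
  rw [← Real.exp_le_exp, Real.exp_add, Real.exp_log two_pos, ← cosh_hypDist hp hq, Real.cosh_eq]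
  have := Real.exp_pos (-hypDist p q)
  linarith

/-- The triangle inequality for the hyperbolic distance, up to an additive constant. -/
theorem logCosh_triangle {p q r : EuclideanSpace F (Fin k)} (hp : p ∈ hypSpace F k)
    (hq : q ∈ hypSpace F k) (hr : r ∈ hypSpace F k) :
    logCosh p r ≤ logCosh p q + logCosh q r + Real.log 2 := by
  have hm := one_sub_norm_sq_pos hp
  have hμ := one_sub_norm_sq_pos hq
  have hν := one_sub_norm_sq_pos hr
  have hpq := norm_pos_iff.2 (one_sub_hermProd_ne_zero hp hq)
  have hqr := norm_pos_iff.2 (one_sub_hermProd_ne_zero hq hr)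
  have hpr := norm_pos_iff.2 (one_sub_hermProd_ne_zero hp hr)
  -- Decomposition of the lifts of `p` and `r` along the lift of `q` and its complement.
  have hid : (1 - ‖q‖ ^ 2) • (1 - hermProd p r) =
      (1 - hermProd p q) * (1 - hermProd q r) - (1 - ‖q‖ ^ 2) • hypForm q (p - q) (r - q) := by
    rw [hypForm, smul_add, smul_smul, mul_inv_cancel₀ hμ.ne', one_smul, ← star_hermProd q (p - q),
      hermProd_left_sub, hermProd_left_sub, star_sub, star_real_smul, star_sub, star_one,
      star_hermProd, hermProd_sub_left, hermProd_left_sub, hermProd_sub_right p]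
    simp only [smul_sub, sub_mul, mul_sub, one_mul, mul_one, smul_mul_assoc, mul_smul_comm]
    module
  have hpq2 := hypFormSq_sub_self hq p
  have hqr2 := hypFormSq_sub_self hq r
  have hsymm : ‖1 - hermProd q p‖ = ‖1 - hermProd p q‖ := by
    rw [← norm_star_eq, star_sub, star_one, star_hermProd]
  rw [hsymm] at hpq2
  have hform : (1 - ‖q‖ ^ 2) * ‖hypForm q (p - q) (r - q)‖ ≤
      ‖1 - hermProd p q‖ * ‖1 - hermProd q r‖ := by
    refine (sq_le_sq₀ (by positivity) (by positivity)).1 ?_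
    rw [mul_pow, mul_pow]
    calc (1 - ‖q‖ ^ 2) ^ 2 * ‖hypForm q (p - q) (r - q)‖ ^ 2
        ≤ (1 - ‖q‖ ^ 2) ^ 2 * (hypFormSq q (p - q) * hypFormSq q (r - q)) :=
          mul_le_mul_of_nonneg_left (norm_hypForm_sq_le hq _ _) (sq_nonneg _)
      _ = ((1 - ‖q‖ ^ 2) * hypFormSq q (p - q)) * ((1 - ‖q‖ ^ 2) * hypFormSq q (r - q)) := by ring
      _ ≤ ‖1 - hermProd p q‖ ^ 2 * ‖1 - hermProd q r‖ ^ 2 := by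
          refine mul_le_mul ?_ ?_ (mul_nonneg hμ.le (hypFormSq_nonneg hq _)) (sq_nonneg _)
          · rw [hpq2]; nlinarith
          · rw [hqr2]; nlinarith
  have hnorm : (1 - ‖q‖ ^ 2) * ‖1 - hermProd p r‖ ≤
      2 * (‖1 - hermProd p q‖ * ‖1 - hermProd q r‖) := by
    have h := congrArg norm hid
    rw [norm_smul, Real.norm_of_nonneg hμ.le] at h
    rw [h]
    refine (norm_sub_le _ _).trans ?_
    rw [norm_mul, norm_smul, Real.norm_of_nonneg hμ.le]
    linarith
  have hlog := Real.log_le_log (mul_pos hμ hpr) hnorm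
  rw [Real.log_mul hμ.ne' hpr.ne', Real.log_mul two_ne_zero (mul_pos hpq hqr).ne',
    Real.log_mul hpq.ne' hqr.ne'] at hlog
  simp only [logCosh, Real.log_pow]
  push_cast
  linarith

theorem ContDiffWithinAt.logCosh {E : Type*} [NormedAddCommGroup E] [NormedSpace ℝ E]
    {n : WithTop ℕ∞} {φ ψ : E → EuclideanSpace F (Fin k)} {s : Set E} {x : E}
    (hφ : ContDiffWithinAt ℝ n φ s x) (hψ : ContDiffWithinAt ℝ n ψ s x)
    (hp : φ x ∈ hypSpace F k) (hq : ψ x ∈ hypSpace F k) :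
    ContDiffWithinAt ℝ n (fun y => logCosh (φ y) (ψ y)) s x := by
  have h1 : ContDiffWithinAt ℝ n (fun y => 1 - hermProd (φ y) (ψ y)) s x :=
    contDiffWithinAt_const.sub
      ((hermProdL F k).isBoundedBilinearMap.contDiff.comp_contDiffWithinAt (hφ.prodMk hψ))
  exact ((((h1.norm_sq ℝ).log
    (pow_ne_zero 2 (norm_ne_zero_iff.2 (one_sub_hermProd_ne_zero hp hq)))).sub
    ((contDiffWithinAt_const.sub (hφ.norm_sq ℝ)).log (one_sub_norm_sq_pos hp).ne')).sub
    ((contDiffWithinAt_const.sub (hψ.norm_sq ℝ)).log (one_sub_norm_sq_pos hq).ne')).div_const 2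

theorem ContDiffAt.logCosh {E : Type*} [NormedAddCommGroup E] [NormedSpace ℝ E]
    {n : WithTop ℕ∞} {φ ψ : E → EuclideanSpace F (Fin k)} {x : E}
    (hφ : ContDiffAt ℝ n φ x) (hψ : ContDiffAt ℝ n ψ x)
    (hp : φ x ∈ hypSpace F k) (hq : ψ x ∈ hypSpace F k) :
    ContDiffAt ℝ n (fun y => logCosh (φ y) (ψ y)) x :=
  ContDiffWithinAt.logCosh (s := Set.univ) hφ hψ hp hq

/-- The second derivative of `logCosh` along a pair of curves; the value of the first derivative is
left unspecified. -/
theorem HasSecondDerivAt.logCosh {p q : ℝ → EuclideanSpace F (Fin k)}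
    {p₁ p₂ q₁ q₂ : EuclideanSpace F (Fin k)} {t : ℝ} (hp : HasSecondDerivAt p p₁ p₂ t)
    (hq : HasSecondDerivAt q q₁ q₂ t) (hp0 : p t ∈ hypSpace F k) (hq0 : q t ∈ hypSpace F k) :
    ∃ a, HasSecondDerivAt (fun s => logCosh (p s) (q s)) a
      ((‖-(hermProd p₁ (q t) + hermProd (p t) q₁)‖ ^ 2
          + inner ℝ (1 - hermProd (p t) (q t)) (-(2 : ℝ) • hermProd p₁ q₁))
            / ‖1 - hermProd (p t) (q t)‖ ^ 2
        - 2 * inner ℝ (1 - hermProd (p t) (q t))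
            (-(hermProd p₁ (q t) + hermProd (p t) q₁)) ^ 2 / ‖1 - hermProd (p t) (q t)‖ ^ 4
        + ‖p₁‖ ^ 2 / (1 - ‖p t‖ ^ 2) + 2 * inner ℝ (p t) p₁ ^ 2 / (1 - ‖p t‖ ^ 2) ^ 2
        + ‖q₁‖ ^ 2 / (1 - ‖q t‖ ^ 2) + 2 * inner ℝ (q t) q₁ ^ 2 / (1 - ‖q t‖ ^ 2) ^ 2
        + (inner ℝ (p t) p₂ / (1 - ‖p t‖ ^ 2)
          - inner ℝ (1 - hermProd (p t) (q t)) (hermProd p₂ (q t))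
            / ‖1 - hermProd (p t) (q t)‖ ^ 2)
        + (inner ℝ (q t) q₂ / (1 - ‖q t‖ ^ 2)
          - inner ℝ (1 - hermProd (p t) (q t)) (hermProd (p t) q₂)
            / ‖1 - hermProd (p t) (q t)‖ ^ 2)) t := by
  have hm := (one_sub_norm_sq_pos hp0).ne'
  have hμ := (one_sub_norm_sq_pos hq0).ne'
  have hc := norm_ne_zero_iff.2 (one_sub_hermProd_ne_zero hp0 hq0)
  have h1 := (((HasSecondDerivAt.const (1 : F) t).sub (hp.bilin (hermProdL F k) hq)).inner_self).log
    (pow_ne_zero 2 hc)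
  have h2 := ((HasSecondDerivAt.const (1 : ℝ) t).sub hp.inner_self).log hm
  have h3 := ((HasSecondDerivAt.const (1 : ℝ) t).sub hq.inner_self).log hμ
  have h4 := ((h1.sub h2).sub h3).const_mul (1 / 2)
  have h5 : (fun s => _root_.logCosh (p s) (q s)) = fun s => 1 / 2 *
      (Real.log (‖1 - hermProdL F k (p s) (q s)‖ ^ 2) - Real.log (1 - ‖p s‖ ^ 2)
        - Real.log (1 - ‖q s‖ ^ 2)) := by
    funext s
    simp only [_root_.logCosh, hermProdL_apply]
    ring
  rw [h5]
  refine ⟨_, h4.congr rfl ?_⟩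
  simp only [hermProdL_apply, zero_sub]
  generalize ‖-(hermProd p₁ (q t) + hermProd (p t) q₁)‖ = A
  simp only [inner_neg_right, inner_add_right, inner_smul_right]
  field_simp
  ring

theorem sum_map_of_map_add {V ι : Type*} [AddCommGroup V] [Fintype ι] (f : V → ℝ)
    (hf : ∀ x y, f (x + y) = f x + f y) (v : ι → V) : ∑ i, f (v i) = f (∑ i, v i) :=
  (map_sum (AddMonoidHom.mk' f hf) v Finset.univ).symm

/-- `log cosh d(φ, ψ)` is subharmonic when `φ` and `ψ` are harmonic maps. -/
theorem laplacian_logCosh_nonneg {n : ℕ} {φ ψ : EuclideanSpace ℝ (Fin n) → EuclideanSpace F (Fin k)}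
    {x : EuclideanSpace ℝ (Fin n)} (hφ : ContDiffAt ℝ 2 φ x) (hψ : ContDiffAt ℝ 2 ψ x)
    (hp : φ x ∈ hypSpace F k) (hq : ψ x ∈ hypSpace F k) (hφ' : HarmonicEqAt φ x)
    (hψ' : HarmonicEqAt ψ x) : 0 ≤ Δ (fun y => logCosh (φ y) (ψ y)) x := by
  have hm := one_sub_norm_sq_pos hp
  have hμ := one_sub_norm_sq_pos hq
  have hc : 0 < ‖1 - hermProd (φ x) (ψ x)‖ ^ 2 :=
    pow_pos (norm_pos_iff.2 (one_sub_hermProd_ne_zero hp hq)) 2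
  have hx : ∀ i : Fin n, x + (0 : ℝ) • EuclideanSpace.single i 1 = x := fun i => by simp
  have h : ∀ i : Fin n, _ := fun i => HasSecondDerivAt.logCosh
    (hφ.hasSecondDerivAt_line (EuclideanSpace.single i 1))
    (hψ.hasSecondDerivAt_line (EuclideanSpace.single i 1)) (by rwa [hx]) (by rwa [hx])
  choose a ha using h
  rw [laplacian_eq_sum_of_hasSecondDerivAt (hφ.logCosh hψ hp hq) ha]
  simp only [hx]
  -- The second derivatives of `φ` and `ψ` enter linearly; they are replaced by those of geodesics.
  have hlin : ∀ v : Fin n → EuclideanSpace F (Fin k),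
      ∑ i, (inner ℝ (φ x) (v i) / (1 - ‖φ x‖ ^ 2) - inner ℝ (1 - hermProd (φ x) (ψ x))
        (hermProd (v i) (ψ x)) / ‖1 - hermProd (φ x) (ψ x)‖ ^ 2) =
      inner ℝ (φ x) (∑ i, v i) / (1 - ‖φ x‖ ^ 2) - inner ℝ (1 - hermProd (φ x) (ψ x))
        (hermProd (∑ i, v i) (ψ x)) / ‖1 - hermProd (φ x) (ψ x)‖ ^ 2 := fun v =>
    sum_map_of_map_add (fun X => inner ℝ (φ x) X / (1 - ‖φ x‖ ^ 2)
      - inner ℝ (1 - hermProd (φ x) (ψ x)) (hermProd X (ψ x)) / ‖1 - hermProd (φ x) (ψ x)‖ ^ 2)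
      (fun X X' => by simp only [inner_add_right, hermProd_add_left]; ring) v
  have hlin' : ∀ v : Fin n → EuclideanSpace F (Fin k),
      ∑ i, (inner ℝ (ψ x) (v i) / (1 - ‖ψ x‖ ^ 2) - inner ℝ (1 - hermProd (φ x) (ψ x))
        (hermProd (φ x) (v i)) / ‖1 - hermProd (φ x) (ψ x)‖ ^ 2) =
      inner ℝ (ψ x) (∑ i, v i) / (1 - ‖ψ x‖ ^ 2) - inner ℝ (1 - hermProd (φ x) (ψ x))
        (hermProd (φ x) (∑ i, v i)) / ‖1 - hermProd (φ x) (ψ x)‖ ^ 2 := fun v =>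
    sum_map_of_map_add (fun X => inner ℝ (ψ x) X / (1 - ‖ψ x‖ ^ 2)
      - inner ℝ (1 - hermProd (φ x) (ψ x)) (hermProd (φ x) X) / ‖1 - hermProd (φ x) (ψ x)‖ ^ 2)
      (fun X X' => by simp only [inner_add_right, hermProd_add_right]; ring) v
  rw [Finset.sum_add_distrib, Finset.sum_add_distrib, hlin, hlin', ← laplacian_eq_sum_iteratedFDeriv,
    ← laplacian_eq_sum_iteratedFDeriv, hφ', hψ', ← hlin, ← hlin', ← Finset.sum_add_distrib,
    ← Finset.sum_add_distrib]
  refine Finset.sum_nonneg fun i _ => ?_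
  change 0 ≤ (‖-(hermProd (partialDeriv φ i x) _ + hermProd _ (partialDeriv ψ i x))‖ ^ 2
    + inner ℝ _ (_ • hermProd (partialDeriv φ i x) (partialDeriv ψ i x))) / _
    - 2 * inner ℝ _ (-(hermProd (partialDeriv φ i x) _ + hermProd _ (partialDeriv ψ i x))) ^ 2 / _
    + ‖partialDeriv φ i x‖ ^ 2 / _ + 2 * inner ℝ _ (partialDeriv φ i x) ^ 2 / _
    + ‖partialDeriv ψ i x‖ ^ 2 / _ + 2 * inner ℝ _ (partialDeriv ψ i x) ^ 2 / _ + _ + _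
  have key := div_nonneg (logCosh_convexity hp hq (partialDeriv φ i x) (partialDeriv ψ i x) _ _
    rfl rfl) hc.le
  refine key.trans_eq ?_
  generalize partialDeriv φ i x = X
  generalize partialDeriv ψ i x = Y
  generalize ‖-(hermProd X (ψ x) + hermProd (φ x) Y)‖ = A
  simp only [inner_neg_right, inner_smul_right, ← neg_smul, hermProd_smul_left,
    hermProd_smul_right, hermProd_rmul_left, hermProd_rmul_right, inner_add_right, inner_sub_right,
    hypFormSq, inner_eq_inner_one_hermProd (φ x), inner_eq_inner_one_hermProd (ψ x),
    inner_one_mul_self, star_hermProd]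
  have hc' : ‖1 - hermProd (φ x) (ψ x)‖ ≠ 0 := by
    rintro h0; rw [h0] at hc; simp at hc
  field_simp
  ring

end LogCosh

/-! ### Harmonic maps into a geodesic -/

section Height

variable {F : Type} [NormedDivisionRing F] [StarRing F] [InnerProductSpace ℝ F]
  [HyperbolicScalars F] {n k : ℕ}

theorem IsHarmonicMap.contDiffAt {Ω S : Set (EuclideanSpace ℝ (Fin n))}
    {φ : EuclideanSpace ℝ (Fin n) → EuclideanSpace F (Fin k)} (h : IsHarmonicMap Ω S φ)
    (hΩ : IsOpen Ω) (hS : IsClosed S) {x : EuclideanSpace ℝ (Fin n)} (hx : x ∈ Ω \ S) :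
    ContDiffAt ℝ ∞ φ x :=
  h.smooth.contDiffAt (Filter.mem_of_superset ((hΩ.sdiff hS).mem_nhds hx)
    (Set.sdiff_subset_sdiff_left subset_closure))

theorem two_le_infty : (2 : WithTop ℕ∞) ≤ ∞ :=
  WithTop.coe_le_coe.2 (le_top : (2 : ℕ∞) ≤ ⊤)

theorem hasSecondDerivAt_cosh (t : ℝ) :
    HasSecondDerivAt Real.cosh (Real.sinh t) (Real.cosh t) t :=
  ⟨Real.sinh, .of_forall Real.hasDerivAt_cosh, rfl, Real.hasDerivAt_sinh t⟩

/-- If `log cosh (s - u)` is subharmonic at `x` for every `s`, then `u` is harmonic at `x`. -/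
theorem laplacian_eq_zero_of_logCosh {u : EuclideanSpace ℝ (Fin n) → ℝ}
    {x : EuclideanSpace ℝ (Fin n)} (hu : ContDiffAt ℝ 2 u x)
    (h : ∀ s : ℝ, 0 ≤ Δ (fun y => Real.log (Real.cosh (s - u y))) x) : Δ u x = 0 := by
  have hx : ∀ i : Fin n, x + (0 : ℝ) • EuclideanSpace.single i 1 = x := fun i => by simp
  set G := ∑ i, fderiv ℝ u x (EuclideanSpace.single i 1) ^ 2
  have key : ∀ r : ℝ, 0 ≤ G - Real.sinh r * Real.cosh r * Δ u x := by
    intro r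
    have hr : u x + r - u x = r := by ring
    have hcd : ContDiffAt ℝ 2 (fun y => Real.log (Real.cosh (u x + r - u y))) x :=
      ((contDiffAt_const.sub hu).cosh).log (Real.cosh_pos _).ne'
    have hd := laplacian_eq_sum_of_hasSecondDerivAt hcd fun i =>
      ((hasSecondDerivAt_cosh _).comp ((HasSecondDerivAt.const (u x + r) 0).sub
        (hu.hasSecondDerivAt_line (EuclideanSpace.single i 1)))).log (Real.cosh_pos _).ne'
    have h0 := h (u x + r)
    rw [hd] at h0
    simp only [hx, hr] at h0
    have hc := Real.cosh_pos r
    have h1 := mul_nonneg (sq_nonneg (Real.cosh r)) h0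
    refine h1.trans_eq ?_
    rw [laplacian_eq_sum_iteratedFDeriv, Finset.mul_sum, Finset.mul_sum, ← Finset.sum_sub_distrib]
    refine Finset.sum_congr rfl fun i _ => ?_
    field_simp
    linear_combination fderiv ℝ u x (EuclideanSpace.single i 1) ^ 2 * Real.cosh_sq r
  by_contra hne
  -- `sinh r * cosh r = sinh (2 r) / 2` takes every real value.
  obtain ⟨r, hr⟩ := Real.sinh_surjective (2 * ((G + 1) / Δ u x))
  have h2 := key (r / 2)
  have h3 : Real.sinh (r / 2) * Real.cosh (r / 2) = (G + 1) / Δ u x := by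
    have := Real.sinh_two_mul (r / 2)
    rw [mul_div_cancel₀ r two_ne_zero, hr] at this
    linarith
  rw [h3, div_mul_cancel₀ _ hne] at h2
  linarith

/-- A singular map into a geodesic is `γ ∘ u`, where `u` is a harmonic function which tends to
infinity at the singular set. -/
theorem IsSingularMapInto.exists_height {S : Set (EuclideanSpace ℝ (Fin n))} (hS : IsClosed S)
    {γ : ℝ → EuclideanSpace F (Fin k)} (hγ : IsHypGeodesic γ)
    {φ : EuclideanSpace ℝ (Fin n) → EuclideanSpace F (Fin k)} (hφ : IsSingularMapInto S γ φ) :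
    ∃ u : EuclideanSpace ℝ (Fin n) → ℝ, (∀ x ∉ S, φ x = γ (u x)) ∧
      (∀ x ∉ S, ContDiffAt ℝ ∞ u x) ∧ (∀ x ∉ S, Δ u x = 0) ∧
      ∀ a ∈ S, ∀ T, ∀ᶠ x in 𝓝 a, x ∉ S → T ≤ u x := by
  have hex : ∀ x, ∃ t, x ∉ S → φ x = γ t := fun x => by
    by_cases hx : x ∈ S
    · exact ⟨0, fun h => absurd hx h⟩
    · obtain ⟨t, ht⟩ := hφ.mem_geodesic x hx
      exact ⟨t, fun _ => ht.symm⟩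
  choose u hu using hex
  have hinj : Function.Injective γ := fun s t hst => by
    have h1 := hγ.2 s t
    have h2 := hγ.2 t t
    rw [hst, h2, sub_self, abs_zero] at h1
    exact sub_eq_zero.1 (abs_eq_zero.1 h1.symm)
  have hsm : ∀ x ∉ S, ContDiffAt ℝ ∞ φ x := fun x hx =>
    hφ.harmonic.contDiffAt isOpen_univ hS ⟨trivial, hx⟩
  have hmem : ∀ x ∉ S, φ x ∈ hypSpace F k := fun x hx => hu x hx ▸ hγ.1 _
  have hcosh : ∀ s, ∀ x ∉ S, Real.exp (logCosh (γ s) (φ x)) = Real.cosh (s - u x) :=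
    fun s x hx => by
      rw [← cosh_hypDist (hγ.1 s) (hmem x hx), hu x hx, hγ.2, Real.cosh_abs]
  have hnhds : ∀ x ∉ S, ∀ᶠ y in 𝓝 x, y ∉ S := fun x hx => hS.isOpen_compl.mem_nhds hx
  have hcd : ∀ s, ∀ x ∉ S, ContDiffAt ℝ ∞ (fun y => logCosh (γ s) (φ y)) x := fun s x hx =>
    contDiffAt_const.logCosh (hsm x hx) (hγ.1 s) (hmem x hx)
  have hucd : ∀ x ∉ S, ContDiffAt ℝ ∞ u x := fun x hx => by
    have hsinh1 : Real.sinh 1 ≠ 0 := (Real.sinh_pos_iff.2 one_pos).ne'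
    -- `sinh u` is a combination of `cosh u` and `cosh (1 - u)`.
    have h1 : ContDiffAt ℝ ∞ (fun y => Real.arsinh ((Real.exp (logCosh (γ 0) (φ y)) * Real.cosh 1
        - Real.exp (logCosh (γ 1) (φ y))) / Real.sinh 1)) x :=
      ((((hcd 0 x hx).exp.mul contDiffAt_const).sub (hcd 1 x hx).exp).div_const _).arsinh
    refine h1.congr_of_eventuallyEq ?_
    filter_upwards [hnhds x hx] with y hy
    have h2 : (Real.exp (logCosh (γ 0) (φ y)) * Real.cosh 1
        - Real.exp (logCosh (γ 1) (φ y))) / Real.sinh 1 = Real.sinh (u y) := by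
      rw [hcosh 0 y hy, hcosh 1 y hy, zero_sub, Real.cosh_neg, Real.cosh_sub, div_eq_iff hsinh1]
      ring
    rw [h2, Real.arsinh_sinh]
  refine ⟨u, hu, hucd, fun x hx => ?_, fun a ha T => ?_⟩
  · refine laplacian_eq_zero_of_logCosh ((hucd x hx).of_le two_le_infty) fun s => ?_
    have h1 : (fun y => Real.log (Real.cosh (s - u y))) =ᶠ[𝓝 x]
        fun y => logCosh (γ s) (φ y) := by
      filter_upwards [hnhds x hx] with y hy
      rw [← hcosh s y hy, Real.log_exp]
    rw [(InnerProductSpace.laplacian_congr_nhds h1).self_of_nhds]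
    exact laplacian_logCosh_nonneg contDiffAt_const
      ((hsm x hx).of_le two_le_infty) (hγ.1 s) (hmem x hx)
      (harmonicEqAt_const _ _) (hφ.harmonic.harmonicEqAt ⟨trivial, hx⟩)
  · have h1 := Filter.eventually_inf_principal.1 (hφ.tendsto_end T)
    filter_upwards [(eventually_nhdsSet_iff_forall.1 h1) a ha] with x hx hxS
    obtain ⟨t, ht, hγt⟩ := hx hxS
    rw [hu x hxS] at hγt
    exact hinj hγt ▸ ht

end Height

/-! ### The maximum principle -/

section MaximumPrinciple

/-- A function which is locally bounded above on `D` at each point of a compact set is bounded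
above on the part of `D` in that set. -/
theorem IsCompact.exists_forall_le_of_local {X : Type*} [TopologicalSpace X] {K D : Set X}
    (hK : IsCompact K) {f : X → ℝ} (h : ∀ a ∈ K, ∃ C, ∀ᶠ x in 𝓝[K] a, x ∈ D → f x ≤ C) :
    ∃ C, 0 ≤ C ∧ ∀ x ∈ K, x ∈ D → f x ≤ C := by
  refine hK.induction_on (p := fun s => ∃ C, 0 ≤ C ∧ ∀ x ∈ s, x ∈ D → f x ≤ C)
    ⟨0, le_rfl, by simp⟩ ?_ ?_ ?_
  · rintro s t hst ⟨C, hC, h⟩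
    exact ⟨C, hC, fun x hx => h x (hst hx)⟩
  · rintro s t ⟨C, hC, h⟩ ⟨C', hC', h'⟩
    refine ⟨max C C', hC.trans (le_max_left _ _), fun x hx hD => ?_⟩
    rcases hx with hx | hx
    · exact (h x hx hD).trans (le_max_left _ _)
    · exact (h' x hx hD).trans (le_max_right _ _)
  · intro a ha
    obtain ⟨C, hC⟩ := h a ha
    exact ⟨_, hC, max C 0, le_max_right _ _, fun x hx hD => (hx hD).trans (le_max_left _ _)⟩

variable {n : ℕ}

theorem laplacian_norm_sq (x : EuclideanSpace ℝ (Fin n)) :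
    Δ (fun y : EuclideanSpace ℝ (Fin n) => ‖y‖ ^ 2) x = 2 * n := by
  have hid : ContDiffAt ℝ 2 (fun y : EuclideanSpace ℝ (Fin n) => y) x := contDiffAt_id
  have hline : ∀ v : EuclideanSpace ℝ (Fin n), HasSecondDerivAt (fun t : ℝ => x + t • v) v 0 0 :=
    fun v => ⟨fun _ => v, .of_forall fun t => by
      simpa using ((hasDerivAt_id t).smul_const v).const_add x, rfl, hasDerivAt_const _ _⟩
  rw [laplacian_eq_sum_of_hasSecondDerivAt (hid.norm_sq ℝ) fun i =>
    (hline (EuclideanSpace.single i 1)).inner_self]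
  simp [mul_comm]

/-- The maximum principle for a subharmonic function `f` on `U \ S` which is bounded above near
`S`. The set `S` is removable because some superharmonic function `w` tends to infinity there. -/
theorem nonpos_of_laplacian_nonneg (hn : 0 < n) {U S : Set (EuclideanSpace ℝ (Fin n))}
    (hU : IsOpen U) (hUb : Bornology.IsBounded U) (hS : IsClosed S)
    {f w : EuclideanSpace ℝ (Fin n) → ℝ}
    (hf : ∀ x ∈ U \ S, ContDiffAt ℝ 2 f x) (hw : ∀ x ∈ U \ S, ContDiffAt ℝ 2 w x)
    (hΔf : ∀ x ∈ U \ S, 0 ≤ Δ f x) (hΔw : ∀ x ∈ U \ S, Δ w x ≤ 0)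
    (hfc : ContinuousOn f (closure U \ S)) (hwc : ContinuousOn w (closure U \ S))
    (hbd : ∀ x ∈ frontier U \ S, f x ≤ 0)
    (hfS : ∀ a ∈ S, a ∈ closure U → ∃ C, ∀ᶠ x in 𝓝 a, x ∈ U \ S → f x ≤ C)
    (hwS : ∀ a ∈ S, ∀ T, ∀ᶠ x in 𝓝 a, x ∉ S → T ≤ w x) :
    ∀ x ∈ U \ S, f x ≤ 0 := by
  have hcl : IsCompact (closure U) := hUb.isCompact_closure
  -- `w - ‖x‖²` is bounded below on `U \ S`, as it is locally bounded below on the closure of `U`.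
  have hwlow : ∃ C, 0 ≤ C ∧ ∀ x ∈ closure U, x ∈ Sᶜ → -(w x - ‖x‖ ^ 2) ≤ C := by
    refine hcl.exists_forall_le_of_local fun a ha => ?_
    have hnorm : ∀ᶠ x in 𝓝 a, ‖x‖ ^ 2 < ‖a‖ ^ 2 + 1 :=
      ((continuous_norm.pow 2).tendsto a).eventually (gt_mem_nhds (lt_add_one _))
    by_cases haS : a ∈ S
    · refine ⟨‖a‖ ^ 2 + 1, mem_nhdsWithin_of_mem_nhds ?_⟩
      filter_upwards [hwS a haS 0, hnorm] with x hx hx' hxS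
      linarith [hx hxS]
    · refine ⟨-w a + 1 + (‖a‖ ^ 2 + 1), ?_⟩
      have h1 : ∀ᶠ x in 𝓝[closure U \ S] a, w a - 1 < w x :=
        (hwc a ⟨ha, haS⟩).tendsto.eventually (lt_mem_nhds (by linarith))
      rw [Set.sdiff_eq, nhdsWithin_inter_of_mem' (mem_nhdsWithin_of_mem_nhds
        (hS.isOpen_compl.mem_nhds haS))] at h1
      filter_upwards [h1, mem_nhdsWithin_of_mem_nhds hnorm] with x hx hx' _
      linarith
  obtain ⟨C, -, hC⟩ := hwlow
  -- `W` is nonnegative, strictly superharmonic, and infinite on `S`.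
  set W : EuclideanSpace ℝ (Fin n) → ℝ := fun x => w x - ‖x‖ ^ 2 + C with hW
  have hW0 : ∀ x ∈ closure U \ S, 0 ≤ W x := fun x hx => by
    have := hC x hx.1 hx.2
    simp only [hW]
    linarith
  have key : ∀ ε : ℝ, 0 < ε → ∀ x ∈ U \ S, f x ≤ ε * W x := by
    intro ε hε x₀ hx₀
    by_contra! hlt
    set g : EuclideanSpace ℝ (Fin n) → ℝ := fun x => f x - ε * W x with hg
    have hgx₀ : 0 < g x₀ := sub_pos.2 hlt
    have hgc : ContinuousOn g (closure U \ S) :=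
      hfc.sub (continuousOn_const.mul ((hwc.sub (by fun_prop)).add continuousOn_const))
    set K := {x | x ∈ closure U \ S ∧ g x₀ ≤ g x} with hK
    have hKU : K ⊆ U := by
      rintro x ⟨hx, hgx⟩
      by_contra hxU
      have h1 := hbd x ⟨⟨hx.1, by rwa [hU.interior_eq]⟩, hx.2⟩
      have h2 := mul_nonneg hε.le (hW0 x hx)
      have h3 : g x = f x - ε * W x := rfl
      linarith
    -- `K` stays away from `S`, where `w` is infinite and `f` is bounded above.
    have hKc : IsCompact K := by
      refine hcl.of_isClosed_subset (isClosed_of_closure_subset fun a ha => ?_) fun x hx => hx.1.1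
      have hacl : a ∈ closure U := closure_mono hKU ha
      by_cases haS : a ∈ S
      · obtain ⟨C', hC'⟩ := hfS a haS hacl
        have hnorm : ∀ᶠ x in 𝓝 a, ‖x‖ ^ 2 < ‖a‖ ^ 2 + 1 :=
          ((continuous_norm.pow 2).tendsto a).eventually (gt_mem_nhds (lt_add_one _))
        have hev : ∀ᶠ x in 𝓝 a, x ∉ K := by
          filter_upwards [hC', hwS a haS (C' / ε + (‖a‖ ^ 2 + 1) - C), hnorm] with x h1 h2 h3 hxK
          have h4 := h1 ⟨hKU hxK, hxK.1.2⟩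
          have h5 : C' / ε < W x := by
            simp only [hW]
            linarith [h2 hxK.1.2]
          rw [div_lt_iff₀ hε] at h5
          have h6 : g x₀ ≤ f x - ε * W x := hxK.2
          linarith
        exact absurd hev ((mem_closure_iff_frequently.1 ha))
      · refine ⟨⟨hacl, haS⟩, ?_⟩
        have := mem_closure_iff_nhdsWithin_neBot.1 ha
        exact ge_of_tendsto ((hgc a ⟨hacl, haS⟩).mono fun x (hx : x ∈ K) => hx.1)
          (eventually_nhdsWithin_of_forall fun x (hx : x ∈ K) => hx.2)
    obtain ⟨x₁, hx₁, hmax⟩ := hKc.exists_isMaxOn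
      ⟨x₀, ⟨subset_closure hx₀.1, hx₀.2⟩, le_rfl⟩ (hgc.mono fun x hx => hx.1)
    have hx₁' : x₁ ∈ U \ S := ⟨hKU hx₁, hx₁.1.2⟩
    have hloc : IsLocalMax g x₁ := by
      filter_upwards [(hU.sdiff hS).mem_nhds hx₁'] with y hy
      by_cases hyK : y ∈ K
      · exact hmax hyK
      · have : ¬ g x₀ ≤ g y := fun h => hyK ⟨⟨subset_closure hy.1, hy.2⟩, h⟩
        exact (not_le.1 this).le.trans hx₁.2
    have hnsq : ContDiffAt ℝ 2 (fun y : EuclideanSpace ℝ (Fin n) => ‖y‖ ^ 2) x₁ :=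
      contDiffAt_id.norm_sq ℝ
    have hw1 := hw x₁ hx₁'
    have hf1 := hf x₁ hx₁'
    have hg' : g = (f - ε • (w - fun y => ‖y‖ ^ 2)) + fun _ => -(ε * C) := by
      funext y
      simp [hg, hW]
      ring
    have hwn : ContDiffAt ℝ 2 (w - fun y => ‖y‖ ^ 2) x₁ := hw1.sub hnsq
    have hsub : ContDiffAt ℝ 2 (ε • (w - fun y => ‖y‖ ^ 2)) x₁ := hwn.const_smul ε
    have hfsub : ContDiffAt ℝ 2 (f - ε • (w - fun y => ‖y‖ ^ 2)) x₁ := hf1.sub hsub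
    have hgcd : ContDiffAt ℝ 2 g x₁ := by
      rw [hg']
      exact hfsub.add contDiffAt_const
    have hΔ := hloc.laplacian_nonpos hgcd
    rw [hg', hfsub.laplacian_add contDiffAt_const,
      hf1.laplacian_sub hsub, InnerProductSpace.laplacian_smul ε hwn,
      hw1.laplacian_sub hnsq, laplacian_norm_sq, InnerProductSpace.laplacian_const] at hΔ
    have h1 := hΔf x₁ hx₁'
    have h2 := hΔw x₁ hx₁'
    have h3 : (0 : ℝ) < n := Nat.cast_pos.2 hn
    simp only [Pi.zero_apply, smul_eq_mul, add_zero] at hΔ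
    nlinarith [mul_nonneg hε.le (neg_nonneg.2 h2), mul_pos hε h3]
  intro x hx
  refine le_of_forall_pos_le_add fun δ hδ => ?_
  have hWx := hW0 x ⟨subset_closure hx.1, hx.2⟩
  have h1 := key (δ / (W x + 1)) (by positivity) x hx
  have h2 : δ / (W x + 1) * W x ≤ δ := by
    rw [div_mul_eq_mul_div, div_le_iff₀ (by linarith)]
    nlinarith
  linarith

end MaximumPrinciple

/-! ### Superharmonic functions with prescribed singularities -/

section Barrier

variable {n : ℕ}

/-- A smooth, positive, bounded function on `ℝⁿ` whose Laplacian is negative everywhere. -/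
theorem exists_strictly_superharmonic (hn : 3 ≤ n) :
    ∃ h : EuclideanSpace ℝ (Fin n) → ℝ, ContDiff ℝ ∞ h ∧ (∀ x, 0 < h x) ∧ (∀ x, h x ≤ 1) ∧
      ∀ x, Δ h x < 0 := by
  have hpos : ∀ x : EuclideanSpace ℝ (Fin n), 0 < 1 + ‖x‖ ^ 2 := fun x => by positivity
  have hcd : ContDiff ℝ ∞ fun x : EuclideanSpace ℝ (Fin n) => (1 + ‖x‖ ^ 2) ^ (-(1 / 2) : ℝ) :=
    (contDiff_const.add (contDiff_id.norm_sq ℝ)).rpow_const_of_ne fun x => (hpos x).ne'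
  refine ⟨fun x => (1 + ‖x‖ ^ 2) ^ (-(1 / 2) : ℝ), hcd, fun x => Real.rpow_pos_of_pos (hpos x) _,
    fun x => Real.rpow_le_one_of_one_le_of_nonpos (by nlinarith [sq_nonneg ‖x‖]) (by norm_num),
    fun x => ?_⟩
  have hline : ∀ v : EuclideanSpace ℝ (Fin n), HasSecondDerivAt (fun t : ℝ => x + t • v) v 0 0 :=
    fun v => ⟨fun _ => v, .of_forall fun t => by
      simpa using ((hasDerivAt_id t).smul_const v).const_add x, rfl, hasDerivAt_const _ _⟩
  have hpow : ∀ y : ℝ, 0 < y → HasSecondDerivAt (fun y : ℝ => y ^ (-(1 / 2) : ℝ))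
      (-(1 / 2) * y ^ (-(1 / 2) - 1 : ℝ))
      (-(1 / 2) * ((-(1 / 2) - 1) * y ^ (-(1 / 2) - 1 - 1 : ℝ))) y := fun y hy =>
    ⟨fun z => -(1 / 2) * z ^ (-(1 / 2) - 1 : ℝ), by
      filter_upwards [lt_mem_nhds hy] with z hz using Real.hasDerivAt_rpow_const (.inl hz.ne'),
      rfl, (Real.hasDerivAt_rpow_const (.inl hy.ne')).const_mul _⟩
  have hx : ∀ v : EuclideanSpace ℝ (Fin n), x + (0 : ℝ) • v = x := fun v => by simp
  rw [laplacian_eq_sum_of_hasSecondDerivAt (hcd.contDiffAt.of_le two_le_infty) fun i =>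
    HasSecondDerivAt.comp
      (f := fun t : ℝ => 1 + ‖x + t • EuclideanSpace.single i (1 : ℝ)‖ ^ 2) (hpow _ (hpos _))
      ((HasSecondDerivAt.const 1 0).add (hline (EuclideanSpace.single i 1)).inner_self)]
  simp only [hx]
  have hsplit : (1 + ‖x‖ ^ 2) ^ (-(1 / 2) - 1 : ℝ) =
      (1 + ‖x‖ ^ 2) ^ (-(1 / 2) - 1 - 1 : ℝ) * (1 + ‖x‖ ^ 2) := by
    rw [← Real.rpow_add_one (hpos x).ne']
    congr 1
    ring
  rw [hsplit]
  have hP := Real.rpow_pos_of_pos (hpos x) (-(1 / 2) - 1 - 1)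
  generalize (1 + ‖x‖ ^ 2) ^ (-(1 / 2) - 1 - 1 : ℝ) = P at hP
  have hsum : ∑ i : Fin n, x i ^ 2 = ‖x‖ ^ 2 := (EuclideanSpace.real_norm_sq_eq x).symm
  have htot : ∑ i : Fin n, (-(1 / 2) * ((-(1 / 2) - 1) * P) *
      (0 + 2 * inner ℝ x (EuclideanSpace.single i (1 : ℝ))) ^ 2 +
      -(1 / 2) * (P * (1 + ‖x‖ ^ 2)) * (0 + (2 * ‖EuclideanSpace.single i (1 : ℝ)‖ ^ 2 +
        2 * inner ℝ x 0))) = P * (3 * ‖x‖ ^ 2 - n * (1 + ‖x‖ ^ 2)) := by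
    rw [mul_sub, ← hsum, Finset.mul_sum, Finset.mul_sum]
    simp only [EuclideanSpace.inner_single_right, PiLp.norm_single, inner_zero_right]
    rw [Finset.sum_add_distrib, hsum]
    simp only [Finset.sum_const, Finset.card_univ, Fintype.card_fin]
    congr 1
    · refine Finset.sum_congr rfl fun i _ => ?_
      simp
      ring
    · simp
      ring
  rw [htot]
  -- `n ≥ 3` makes the second factor negative.
  have h3 : (3 : ℝ) ≤ n := by exact_mod_cast hn
  refine mul_neg_of_pos_of_neg hP ?_
  nlinarith [sq_nonneg ‖x‖]

theorem ContDiffAt.continuousAt_laplacian {f : EuclideanSpace ℝ (Fin n) → ℝ}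
    {x : EuclideanSpace ℝ (Fin n)} (hf : ContDiffAt ℝ 2 f x) : ContinuousAt (Δ f) x := by
  have h : Δ f = fun y => ∑ i, iteratedFDeriv ℝ 2 f y
      ![EuclideanSpace.single i 1, EuclideanSpace.single i 1] :=
    funext fun y => laplacian_eq_sum_iteratedFDeriv f y
  rw [h]
  have hc := hf.continuousAt_iteratedFDeriv (k := 2) le_rfl
  refine tendsto_finsetSum _ fun i _ => ?_
  exact ((ContinuousMultilinearMap.apply ℝ (fun _ : Fin 2 => EuclideanSpace ℝ (Fin n)) ℝ
    ![EuclideanSpace.single i 1, EuclideanSpace.single i 1]).continuous.tendsto _).comp hc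

/-- If `u` is harmonic off `S` and infinite on `S`, then a compact relatively open part `A` of `S`
carries a nonnegative superharmonic function which dominates `u` near `A` and is bounded on closed
sets disjoint from `A`. -/
theorem exists_superharmonic_of_harmonic (hn : 3 ≤ n) {S A P : Set (EuclideanSpace ℝ (Fin n))}
    (hA : IsCompact A) (hP : IsClosed P) (hAP : Disjoint A P) (hSA : S = A ∪ P)
    {u : EuclideanSpace ℝ (Fin n) → ℝ} (hu : ∀ x ∉ S, ContDiffAt ℝ ∞ u x)
    (hΔu : ∀ x ∉ S, Δ u x = 0) (huS : ∀ a ∈ S, ∀ T, ∀ᶠ x in 𝓝 a, x ∉ S → T ≤ u x) :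
    ∃ v : EuclideanSpace ℝ (Fin n) → ℝ, (∀ x ∉ S, ContDiffAt ℝ 2 v x) ∧ (∀ x ∉ S, Δ v x ≤ 0) ∧
      (∀ x ∉ S, 0 ≤ v x) ∧ (∀ a ∈ A, ∀ᶠ x in 𝓝 a, x ∉ S → u x ≤ v x) ∧
      ∀ D : Set (EuclideanSpace ℝ (Fin n)), IsClosed D → Disjoint D A →
        ∃ M, ∀ x ∈ D \ S, v x ≤ M := by
  obtain ⟨h, hcd, hpos, hle, hΔ⟩ := exists_strictly_superharmonic hn
  obtain ⟨L, hL, hAL, hLP⟩ := exists_compact_between hA hP.isOpen_compl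
    (Set.subset_compl_iff_disjoint_right.2 hAP)
  obtain ⟨χ, hχ1, hχ0, -⟩ := exists_contMDiffMap_one_nhds_of_subset_interior
    (I := modelWithCornersSelf ℝ (EuclideanSpace ℝ (Fin n))) (n := (⊤ : ℕ∞)) hA.isClosed hAL
  have hχcd : ContDiff ℝ ∞ χ := χ.contMDiff.contDiff
  have hcutoff : ∀ x ∉ S, ContDiffAt ℝ 2 (fun y => χ y * u y) x := fun x hx =>
    (hχcd.contDiffAt.mul (hu x hx)).of_le two_le_infty
  have hh2 : ∀ x, ContDiffAt ℝ 2 h x := fun x => hcd.contDiffAt.of_le two_le_infty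
  have hLA : ∀ a ∈ L, a ∉ A → a ∉ S := fun a ha haA haS => by
    rw [hSA] at haS
    exact haS.elim haA (hLP ha)
  have hχ1' : ∀ a ∈ A, ∀ᶠ x in 𝓝 a, χ x = 1 := eventually_nhdsSet_iff_forall.1 hχ1
  have hAS : ∀ a ∈ A, a ∈ S := fun a ha => hSA ▸ Or.inl ha
  -- The Laplacian of `χ u` vanishes near `A`, hence is bounded by a multiple of `-Δ h`.
  obtain ⟨M₁, hM₁, hΔM₁⟩ : ∃ C, 0 ≤ C ∧ ∀ x ∈ L, x ∈ Sᶜ →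
      Δ (fun y => χ y * u y) x / -Δ h x ≤ C := by
    refine hL.exists_forall_le_of_local fun a ha => ?_
    by_cases haA : a ∈ A
    · refine ⟨0, mem_nhdsWithin_of_mem_nhds ?_⟩
      filter_upwards [(hχ1' a haA).eventually_nhds] with x hx hxS
      have h1 : (fun y => χ y * u y) =ᶠ[𝓝 x] u := by
        filter_upwards [hx] with y hy
        rw [hy, one_mul]
      rw [(InnerProductSpace.laplacian_congr_nhds h1).self_of_nhds, hΔu x hxS, zero_div]
    · refine ⟨Δ (fun y => χ y * u y) a / -Δ h a + 1, mem_nhdsWithin_of_mem_nhds ?_⟩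
      have h1 : ContinuousAt (fun x => Δ (fun y => χ y * u y) x / -Δ h x) a :=
        (hcutoff a (hLA a ha haA)).continuousAt_laplacian.div
          (hh2 a).continuousAt_laplacian.neg (neg_ne_zero.2 (hΔ a).ne)
      filter_upwards [h1.eventually (gt_mem_nhds (lt_add_one _))] with x hx _ using hx.le
  -- A second multiple of `h` compensates for negative values of `u` on the support of `χ`.
  obtain ⟨M₂, hM₂, hlow⟩ : ∃ C, 0 ≤ C ∧ ∀ x ∈ L, x ∈ Sᶜ → -(χ x * u x) / h x ≤ C := by
    refine hL.exists_forall_le_of_local fun a ha => ?_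
    by_cases haA : a ∈ A
    · refine ⟨0, mem_nhdsWithin_of_mem_nhds ?_⟩
      filter_upwards [hχ1' a haA, huS a (hAS a haA) 0] with x hx hx' hxS
      rw [hx, one_mul]
      exact div_nonpos_of_nonpos_of_nonneg (neg_nonpos.2 (hx' hxS)) (hpos x).le
    · refine ⟨-(χ a * u a) / h a + 1, mem_nhdsWithin_of_mem_nhds ?_⟩
      have h1 : ContinuousAt (fun x => -(χ x * u x) / h x) a :=
        (hcutoff a (hLA a ha haA)).continuousAt.neg.div hcd.continuous.continuousAt (hpos a).ne'
      filter_upwards [h1.eventually (gt_mem_nhds (lt_add_one _))] with x hx _ using hx.le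
  set M := M₁ + M₂ with hM
  have hM0 : 0 ≤ M := add_nonneg hM₁ hM₂
  have hvcd : ∀ x ∉ S, ContDiffAt ℝ 2 ((fun y => χ y * u y) + M • h) x := fun x hx =>
    (hcutoff x hx).add ((hh2 x).const_smul M)
  refine ⟨(fun y => χ y * u y) + M • h, hvcd, fun x hx => ?_, fun x hx => ?_, fun a ha => ?_,
    fun D hD hDA => ?_⟩
  · have hMh : ContDiffAt ℝ 2 (M • h) x := (hh2 x).const_smul M
    rw [(hcutoff x hx).laplacian_add hMh,
      InnerProductSpace.laplacian_smul M (hh2 x), smul_eq_mul]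
    have hΔx := hΔ x
    by_cases hxL : x ∈ L
    · have h1 := hΔM₁ x hxL hx
      rw [div_le_iff₀ (by linarith)] at h1
      nlinarith
    · have h1 : (fun y => χ y * u y) =ᶠ[𝓝 x] fun _ => 0 := by
        filter_upwards [hL.isClosed.isOpen_compl.mem_nhds hxL] with y hy
        rw [hχ0 y hy, zero_mul]
      rw [(InnerProductSpace.laplacian_congr_nhds h1).self_of_nhds,
        InnerProductSpace.laplacian_const]
      simp only [Pi.zero_apply]
      nlinarith
  · have hx0 := hpos x
    simp only [Pi.add_apply, Pi.smul_apply, smul_eq_mul]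
    by_cases hxL : x ∈ L
    · have h1 := hlow x hxL hx
      rw [div_le_iff₀ hx0] at h1
      nlinarith
    · rw [hχ0 x hxL, zero_mul, zero_add]
      exact mul_nonneg hM0 hx0.le
  · filter_upwards [hχ1' a ha] with x hx _
    have := hpos x
    simp only [Pi.add_apply, Pi.smul_apply, smul_eq_mul, hx, one_mul]
    have : 0 ≤ M * h x := by positivity
    linarith
  · obtain ⟨C, hC, hCD⟩ : ∃ C, 0 ≤ C ∧ ∀ x ∈ L ∩ D, x ∈ Set.univ → χ x * u x ≤ C := by
      refine (hL.inter_right hD).exists_forall_le_of_local fun a ha =>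
        ⟨χ a * u a + 1, mem_nhdsWithin_of_mem_nhds ?_⟩
      have haS := hLA a ha.1 (Set.disjoint_left.1 hDA ha.2)
      filter_upwards [(hcutoff a haS).continuousAt.eventually (gt_mem_nhds (lt_add_one _))]
        with x hx _ using hx.le
    refine ⟨C + M, fun x hx => ?_⟩
    simp only [Pi.add_apply, Pi.smul_apply, smul_eq_mul]
    have hMh : M * h x ≤ M := mul_le_of_le_one_right (by positivity) (hle x)
    by_cases hxL : x ∈ L
    · linarith [hCD x ⟨hxL, hx.1⟩ trivial]
    · rw [hχ0 x hxL]
      linarith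

end Barrier

/-! ### The a priori bound -/

section APriori

variable {F : Type} [NormedDivisionRing F] [StarRing F] [InnerProductSpace ℝ F]
  [HyperbolicScalars F] {n N k : ℕ} {S : Fin (N + 1) → Set (EuclideanSpace ℝ (Fin n))}
  {γ : Fin (N + 1) → ℝ → EuclideanSpace F (Fin k)}
  {φs : Fin (N + 1) → EuclideanSpace ℝ (Fin n) → EuclideanSpace F (Fin k)}
  {φt : EuclideanSpace ℝ (Fin n) → EuclideanSpace F (Fin k)}

theorem IsSingularSet.isClosed_iUnion (hS : IsSingularSet S) : IsClosed (⋃ i, S i) :=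
  isClosed_iUnion_of_finite hS.closed

theorem IsSingularSet.isClosed_unboundedPart (hS : IsSingularSet S) :
    IsClosed (unboundedPart S) :=
  isClosed_iUnion_of_finite fun j => isClosed_iUnion_of_finite fun _ => hS.closed j

theorem unboundedPart_subset : unboundedPart S ⊆ ⋃ i, S i :=
  Set.iUnion_mono fun _ => Set.iUnion_subset fun _ => subset_rfl

theorem IsSingularSet.notMem_unboundedPart (hS : IsSingularSet S) {j : Fin (N + 1)}
    (hj : Bornology.IsBounded (S j)) {a : EuclideanSpace ℝ (Fin n)} (ha : a ∈ S j) :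
    a ∉ unboundedPart S := by
  intro h
  simp only [unboundedPart, Set.mem_iUnion] at h
  obtain ⟨i, hi, hai⟩ := h
  have hij : i ≠ j := fun h => hi (h ▸ hj)
  exact Set.disjoint_left.1 (hS.disjoint i j hij) hai ha

namespace IsSingularDirichletData

theorem contDiffAt_tilde (hdata : IsSingularDirichletData S γ φs φt) (hS : IsSingularSet S)
    {x : EuclideanSpace ℝ (Fin n)} (hx : x ∉ unboundedPart S) : ContDiffAt ℝ ∞ φt x :=
  hdata.harmonic_tilde.contDiffAt isOpen_univ hS.isClosed_unboundedPart ⟨trivial, hx⟩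

theorem mem_tilde (hdata : IsSingularDirichletData S γ φs φt)
    {x : EuclideanSpace ℝ (Fin n)} (hx : x ∉ unboundedPart S) : φt x ∈ hypSpace F k :=
  hdata.harmonic_tilde.mapsTo ⟨subset_closure trivial, hx⟩

theorem contDiffAt (hdata : IsSingularDirichletData S γ φs φt) (hS : IsSingularSet S)
    (j : Fin (N + 1)) {x : EuclideanSpace ℝ (Fin n)} (hx : x ∉ ⋃ i, S i) :
    ContDiffAt ℝ ∞ (φs j) x :=
  (hdata.singular j).harmonic.contDiffAt isOpen_univ hS.isClosed_iUnion ⟨trivial, hx⟩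

theorem mem (hdata : IsSingularDirichletData S γ φs φt) (j : Fin (N + 1))
    {x : EuclideanSpace ℝ (Fin n)} (hx : x ∉ ⋃ i, S i) : φs j x ∈ hypSpace F k :=
  (hdata.singular j).harmonic.mapsTo ⟨subset_closure trivial, hx⟩

/-- All the maps `φⱼ` grow at most like the height of `φ₀` along its geodesic. -/
theorem exists_growth (hdata : IsSingularDirichletData S γ φs φt)
    {u : EuclideanSpace ℝ (Fin n) → ℝ} (hu : ∀ x ∉ ⋃ i, S i, φs 0 x = γ 0 (u x)) :
    ∃ p₀ ∈ hypSpace F k, ∃ C, ∀ j, ∀ x ∉ ⋃ i, S i, logCosh p₀ (φs j x) ≤ |u x| + C := by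
  obtain ⟨p₀, hp₀, C, hC⟩ := hdata.dist_bounded
  refine ⟨p₀, hp₀, logCosh p₀ (γ 0 0) + 2 * Real.log 2 + C, fun j x hx => ?_⟩
  have hγ := hdata.geodesic 0
  have h1 := (abs_le.1 (hC j 0 x hx)).2
  have h2 := logCosh_le_hypDist hp₀ (hdata.mem j hx)
  have h3 := hypDist_le_logCosh_add hp₀ (hdata.mem 0 hx)
  have h4 := logCosh_triangle hp₀ (hγ.1 0) (hdata.mem 0 hx)
  have h5 := logCosh_le_hypDist (hγ.1 0) (hdata.mem 0 hx)
  rw [hu x hx] at h3 h4 h5 h1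
  rw [hγ.2, zero_sub, abs_neg] at h5
  linarith

end IsSingularDirichletData

namespace SolvesDirichletProblem

variable {B : Set (EuclideanSpace ℝ (Fin n))}
  {φ : EuclideanSpace ℝ (Fin n) → EuclideanSpace F (Fin k)} {u v : EuclideanSpace ℝ (Fin n) → ℝ}

/-- The distance of a solution to `φ̃` is controlled by a superharmonic function `v` which dominates
the height `u` near the bounded components of the singular set. -/
theorem logCosh_le (hφ : SolvesDirichletProblem S φs φt B φ) (hn : 0 < n) (hS : IsSingularSet S)
    (hdata : IsSingularDirichletData S γ φs φt) (hB : IsOpen B) (hBb : Bornology.IsBounded B)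
    (hu : ∀ x ∉ ⋃ i, S i, φs 0 x = γ 0 (u x)) (hucd : ∀ x ∉ ⋃ i, S i, ContDiffAt ℝ 2 u x)
    (hΔu : ∀ x ∉ ⋃ i, S i, Δ u x = 0)
    (huS : ∀ a ∈ ⋃ i, S i, ∀ T, ∀ᶠ x in 𝓝 a, x ∉ ⋃ i, S i → T ≤ u x)
    (hvcd : ∀ x ∉ ⋃ i, S i, ContDiffAt ℝ 2 v x) (hΔv : ∀ x ∉ ⋃ i, S i, Δ v x ≤ 0)
    (hv0 : ∀ x ∉ ⋃ i, S i, 0 ≤ v x)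
    (huv : ∀ j, Bornology.IsBounded (S j) → ∀ a ∈ S j,
      ∀ᶠ x in 𝓝 a, x ∉ ⋃ i, S i → u x ≤ v x) :
    ∀ x ∈ B \ ⋃ i, S i, logCosh (φ x) (φt x) ≤ v x := by
  have hSc := hS.isClosed_iUnion
  have hP : ∀ x ∉ ⋃ i, S i, x ∉ unboundedPart S := fun x hx h => hx (unboundedPart_subset h)
  have hφmem : ∀ x ∈ B \ ⋃ i, S i, φ x ∈ hypSpace F k := fun x hx =>
    hφ.harmonic.mapsTo ⟨subset_closure hx.1, hx.2⟩
  have hcd : ∀ x ∈ B \ ⋃ i, S i, ContDiffAt ℝ 2 (fun y => logCosh (φ y) (φt y)) x := fun x hx =>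
    ((hφ.harmonic.contDiffAt hB hSc hx).logCosh (hdata.contDiffAt_tilde hS (hP x hx.2))
      (hφmem x hx) (hdata.mem_tilde (hP x hx.2))).of_le two_le_infty
  have key := nonpos_of_laplacian_nonneg (f := (fun y => logCosh (φ y) (φt y)) - v) (w := u)
    hn hB hBb hSc (fun x hx => (hcd x hx).sub (hvcd x hx.2)) (fun x hx => hucd x hx.2) ?_
    (fun x hx => (hΔu x hx.2).le) ?_ (fun x hx => (hucd x hx.2).continuousAt.continuousWithinAt)
    ?_ ?_ huS
  · exact fun x hx => sub_nonpos.1 (key x hx)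
  · intro x hx
    have h1 := laplacian_logCosh_nonneg ((hφ.harmonic.contDiffAt hB hSc hx).of_le two_le_infty)
      ((hdata.contDiffAt_tilde hS (hP x hx.2)).of_le two_le_infty) (hφmem x hx)
      (hdata.mem_tilde (hP x hx.2)) (hφ.harmonic.harmonicEqAt hx)
      (hdata.harmonic_tilde.harmonicEqAt ⟨trivial, hP x hx.2⟩)
    rw [(hcd x hx).laplacian_sub (hvcd x hx.2)]
    linarith [hΔv x hx.2]
  · intro x hx
    exact ((hφ.harmonic.smooth x hx).logCosh
      (hdata.contDiffAt_tilde hS (hP x hx.2)).contDiffWithinAt (hφ.harmonic.mapsTo hx)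
      (hdata.mem_tilde (hP x hx.2))).continuousWithinAt.sub
      (hvcd x hx.2).continuousAt.continuousWithinAt
  · intro x hx
    simp only [Pi.sub_apply]
    rw [hφ.boundary x hx, logCosh_self]
    linarith [hv0 x hx.2]
  · intro a ha _
    obtain ⟨j, haj⟩ := Set.mem_iUnion.1 ha
    obtain ⟨V, hV, hSV, C, hC⟩ := hφ.asymptotic j
    by_cases hj : Bornology.IsBounded (S j)
    · -- Near a bounded component `φ` grows at most like `u`, which is dominated by `v`.
      obtain ⟨p₀, hp₀, C₁, hC₁⟩ := hdata.exists_growth hu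
      have haP := hS.notMem_unboundedPart hj haj
      have hcont : ContinuousAt (fun y => logCosh p₀ (φt y)) a :=
        ((contDiffAt_const (c := p₀)).logCosh (hdata.contDiffAt_tilde hS haP) hp₀
          (hdata.mem_tilde haP)).continuousAt
      refine ⟨C + C₁ + (logCosh p₀ (φt a) + 1) + 2 * Real.log 2, ?_⟩
      filter_upwards [hV.mem_nhds (hSV haj), huS a ha 0, huv j hj a haj,
        hcont.eventually (gt_mem_nhds (lt_add_one _))] with x hxV hux huvx hx hxB
      have hxt := hdata.mem_tilde (hP x hxB.2)
      have h1 := logCosh_triangle (hφmem x hxB) (hdata.mem j hxB.2) hxt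
      have h2 := logCosh_triangle (hdata.mem j hxB.2) hp₀ hxt
      have h3 := hC₁ j x hxB.2
      have h4 := (logCosh_le_hypDist (hφmem x hxB) (hdata.mem j hxB.2)).trans
        (hC x ⟨⟨hxV, hxB.1⟩, hxB.2⟩)
      rw [logCosh_comm] at h3
      rw [abs_of_nonneg (hux hxB.2)] at h3
      have h5 := huvx hxB.2
      simp only [Pi.sub_apply]
      linarith
    · obtain ⟨V', hV', hSV', C', hC'⟩ := hdata.asymptotic_tilde j hj
      refine ⟨C + C' + Real.log 2, ?_⟩
      filter_upwards [hV.mem_nhds (hSV haj), hV'.mem_nhds (hSV' haj)] with x hxV hxV' hxB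
      have hxt := hdata.mem_tilde (hP x hxB.2)
      have h1 := logCosh_triangle (hφmem x hxB) (hdata.mem j hxB.2) hxt
      have h2 := (logCosh_le_hypDist hxt (hdata.mem j hxB.2)).trans
        (hC' x ⟨⟨hxV', trivial⟩, hxB.2⟩)
      have h4 := (logCosh_le_hypDist (hφmem x hxB) (hdata.mem j hxB.2)).trans
        (hC x ⟨⟨hxV, hxB.1⟩, hxB.2⟩)
      rw [logCosh_comm] at h2
      have h5 := hv0 x hxB.2
      simp only [Pi.sub_apply]
      linarith

/-- Around a single component of the singular set, a bound for the distance of a solution to `φⱼ`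
propagates from the boundary of a neighbourhood to its interior. -/
theorem logCosh_le_of_frontier (hφ : SolvesDirichletProblem S φs φt B φ) (hn : 0 < n)
    (hS : IsSingularSet S) (hdata : IsSingularDirichletData S γ φs φt) (hB : IsOpen B)
    (hucd : ∀ x ∉ ⋃ i, S i, ContDiffAt ℝ 2 u x) (hΔu : ∀ x ∉ ⋃ i, S i, Δ u x = 0)
    (huS : ∀ a ∈ ⋃ i, S i, ∀ T, ∀ᶠ x in 𝓝 a, x ∉ ⋃ i, S i → T ≤ u x)
    {W : Set (EuclideanSpace ℝ (Fin n))} (hW : IsOpen W) (hWb : Bornology.IsBounded W)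
    (hWB : closure W ⊆ B) {j : Fin (N + 1)} (hWS : ∀ i, i ≠ j → Disjoint (closure W) (S i))
    {R : ℝ} (hR : ∀ x ∈ frontier W \ ⋃ i, S i, logCosh (φ x) (φs j x) ≤ R) :
    ∀ x ∈ W \ ⋃ i, S i, logCosh (φ x) (φs j x) ≤ R := by
  have hSc := hS.isClosed_iUnion
  have hmemB : ∀ x ∈ closure W \ ⋃ i, S i, x ∈ B \ ⋃ i, S i := fun x hx => ⟨hWB hx.1, hx.2⟩
  have hmemW : ∀ x ∈ W \ ⋃ i, S i, x ∈ B \ ⋃ i, S i := fun x hx =>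
    hmemB x ⟨subset_closure hx.1, hx.2⟩
  have hφmem : ∀ x ∈ B \ ⋃ i, S i, φ x ∈ hypSpace F k := fun x hx =>
    hφ.harmonic.mapsTo ⟨subset_closure hx.1, hx.2⟩
  have hcd : ∀ x ∈ B \ ⋃ i, S i, ContDiffAt ℝ 2 (fun y => logCosh (φ y) (φs j y)) x := fun x hx =>
    ((hφ.harmonic.contDiffAt hB hSc hx).logCosh (hdata.contDiffAt hS j hx.2)
      (hφmem x hx) (hdata.mem j hx.2)).of_le two_le_infty
  have key := nonpos_of_laplacian_nonneg (f := (fun y => logCosh (φ y) (φs j y)) - fun _ => R)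
    (w := u) hn hW hWb hSc (fun x hx => (hcd x (hmemW x hx)).sub contDiffAt_const)
    (fun x hx => hucd x hx.2) ?_ (fun x hx => (hΔu x hx.2).le)
    (fun x hx => ((hcd x (hmemB x hx)).sub contDiffAt_const).continuousAt.continuousWithinAt)
    (fun x hx => (hucd x hx.2).continuousAt.continuousWithinAt)
    (fun x hx => sub_nonpos.2 (hR x hx)) ?_ huS
  · exact fun x hx => sub_nonpos.1 (key x hx)
  · intro x hx
    have hxB := hmemW x hx
    have h1 := laplacian_logCosh_nonneg ((hφ.harmonic.contDiffAt hB hSc hxB).of_le two_le_infty)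
      ((hdata.contDiffAt hS j hx.2).of_le two_le_infty) (hφmem x hxB) (hdata.mem j hx.2)
      (hφ.harmonic.harmonicEqAt hxB) ((hdata.singular j).harmonic.harmonicEqAt ⟨trivial, hx.2⟩)
    rw [(hcd x hxB).laplacian_sub contDiffAt_const, InnerProductSpace.laplacian_const]
    simpa using h1
  · intro a ha haW
    obtain ⟨i, hai⟩ := Set.mem_iUnion.1 ha
    have hij : i = j := by
      by_contra hij
      exact Set.disjoint_left.1 (hWS i hij) haW hai
    obtain ⟨V, hV, hSV, C, hC⟩ := hφ.asymptotic j
    refine ⟨C - R, ?_⟩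
    filter_upwards [hV.mem_nhds (hSV (hij ▸ hai))] with x hxV hxW
    have hxB := hmemW x hxW
    have h4 := (logCosh_le_hypDist (hφmem x hxB) (hdata.mem j hxB.2)).trans
      (hC x ⟨⟨hxV, hxB.1⟩, hxB.2⟩)
    simp only [Pi.sub_apply]
    linarith

end SolvesDirichletProblem

/-- A set which is disjoint from all but one component meets the singular set in that component. -/
theorem notMem_iUnion_of_separates {D : Set (EuclideanSpace ℝ (Fin n))} {j : Fin (N + 1)}
    (h : ∀ i, i ≠ j → Disjoint (closure D) (S i)) {x : EuclideanSpace ℝ (Fin n)}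
    (hx : x ∈ closure D) (hxj : x ∉ S j) : x ∉ ⋃ i, S i := by
  intro hxS
  obtain ⟨i, hi⟩ := Set.mem_iUnion.1 hxS
  by_cases hij : i = j
  · exact hxj (hij ▸ hi)
  · exact Set.disjoint_left.1 (h i hij) hx hi

end APriori

theorem mainTheorem5 (F : Type) [NormedDivisionRing F] [StarRing F] [InnerProductSpace ℝ F]
    [HyperbolicScalars F] (k n N : ℕ) (hn : 3 ≤ n)
    (S : Fin (N + 1) → Set (EuclideanSpace ℝ (Fin n))) (hS : IsSingularSet S)
    (γ : Fin (N + 1) → ℝ → EuclideanSpace F (Fin k))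
    (φs : Fin (N + 1) → EuclideanSpace ℝ (Fin n) → EuclideanSpace F (Fin k))
    (φt : EuclideanSpace ℝ (Fin n) → EuclideanSpace F (Fin k))
    (hdata : IsSingularDirichletData S γ φs φt)
    (Ω' : Fin (N + 1) → Set (EuclideanSpace ℝ (Fin n)))
    (Ωt' : Set (EuclideanSpace ℝ (Fin n)))
    (hcover : IsAdaptedCover S φs φt Ω' Ωt') :
    ∃ R : ℝ, 0 < R ∧
      ∀ (c : EuclideanSpace ℝ (Fin n)) (r : ℝ), 0 < r →
        (∀ j, Bornology.IsBounded (S j) → closure (Ω' j) ⊆ Metric.ball c r) →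
        ∀ φ : EuclideanSpace ℝ (Fin n) → EuclideanSpace F (Fin k),
          SolvesDirichletProblem S φs φt (Metric.ball c r) φ →
          (∀ x ∈ Ωt' ∩ Metric.ball c r, hypDist (φ x) (φt x) ≤ R) ∧
          (∀ j, ∀ x ∈ (Ω' j ∩ Metric.ball c r) \ S j, hypDist (φ x) (φs j x) ≤ R) := by
  have hn0 : 0 < n := by omega
  have hSc := hS.isClosed_iUnion
  have hP : ∀ x ∉ ⋃ i, S i, x ∉ unboundedPart S := fun x hx h => hx (unboundedPart_subset h)
  obtain ⟨u, hu, hucd, hΔu, huS⟩ := (hdata.singular 0).exists_height hSc (hdata.geodesic 0)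
  set A : Set (EuclideanSpace ℝ (Fin n)) :=
    ⋃ (j : Fin (N + 1)) (_ : Bornology.IsBounded (S j)), S j with hAdef
  have hA : IsCompact A := isCompact_iUnion fun j => isCompact_iUnion fun hj =>
    Metric.isCompact_of_isClosed_isBounded (hS.closed j) hj
  have hAP : Disjoint A (unboundedPart S) := by
    refine Set.disjoint_left.2 fun x hx => ?_
    simp only [hAdef, Set.mem_iUnion] at hx
    obtain ⟨j, hj, hxj⟩ := hx
    exact hS.notMem_unboundedPart hj hxj
  have hSA : ⋃ i, S i = A ∪ unboundedPart S := by
    refine Set.Subset.antisymm (Set.iUnion_subset fun j x hx => ?_)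
      (Set.union_subset (Set.iUnion_mono fun _ => Set.iUnion_subset fun _ => subset_rfl)
        unboundedPart_subset)
    by_cases hj : Bornology.IsBounded (S j)
    · exact .inl (Set.mem_iUnion₂.2 ⟨j, hj, hx⟩)
    · exact .inr (Set.mem_iUnion₂.2 ⟨j, hj, hx⟩)
  obtain ⟨v, hvcd, hΔv, hv0, huv, hvD⟩ := exists_superharmonic_of_harmonic hn hA
    hS.isClosed_unboundedPart hAP hSA hucd hΔu huS
  have hucd2 : ∀ x ∉ ⋃ i, S i, ContDiffAt ℝ 2 u x := fun x hx => (hucd x hx).of_le two_le_infty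
  have hle : ∀ (c : EuclideanSpace ℝ (Fin n)) (r : ℝ)
      (φ : EuclideanSpace ℝ (Fin n) → EuclideanSpace F (Fin k)),
      SolvesDirichletProblem S φs φt (Metric.ball c r) φ →
      ∀ x ∈ Metric.ball c r \ ⋃ i, S i, logCosh (φ x) (φt x) ≤ v x := fun c r φ hφ =>
    hφ.logCosh_le hn0 hS hdata Metric.isOpen_ball Metric.isBounded_ball hu hucd2 hΔu huS hvcd hΔv
      hv0 fun i hi a ha => huv a (Set.mem_iUnion₂.2 ⟨i, hi, ha⟩)
  have hdisjA : ∀ {D : Set (EuclideanSpace ℝ (Fin n))},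
      (∀ j, Bornology.IsBounded (S j) → Disjoint D (S j)) → Disjoint D A := fun h =>
    Set.disjoint_iUnion_right.2 fun j => Set.disjoint_iUnion_right.2 fun hj => h j hj
  obtain ⟨Mt, hMt⟩ := hvD (closure Ωt') isClosed_closure
    (hdisjA fun j _ => hcover.separates_tilde j)
  -- A bound for the distance to `φⱼ`, depending only on the data.
  have hRj : ∀ j, ∃ Rj, ∀ (c : EuclideanSpace ℝ (Fin n)) (r : ℝ),
      (∀ j, Bornology.IsBounded (S j) → closure (Ω' j) ⊆ Metric.ball c r) →
      ∀ φ : EuclideanSpace ℝ (Fin n) → EuclideanSpace F (Fin k),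
        SolvesDirichletProblem S φs φt (Metric.ball c r) φ →
        ∀ x ∈ (Ω' j ∩ Metric.ball c r) \ S j, logCosh (φ x) (φs j x) ≤ Rj := by
    intro j
    have hsep : ∀ i, i ≠ j → Disjoint (closure (Ω' j)) (S i) := fun i hij =>
      hcover.separates j i hij.symm
    by_cases hj : Bornology.IsBounded (S j)
    · have hfrS : ∀ x ∈ frontier (Ω' j), x ∉ ⋃ i, S i := fun x hx =>
        notMem_iUnion_of_separates hsep (frontier_subset_closure hx) fun hxj =>
          hx.2 ((hcover.isOpen j).interior_eq.symm ▸ hcover.subset j hxj)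
      have hfr : IsCompact (frontier (Ω' j)) :=
        (hcover.bounded j hj).isCompact_closure.of_isClosed_subset isClosed_frontier
          frontier_subset_closure
      obtain ⟨M, hM⟩ := hvD (frontier (Ω' j)) isClosed_frontier
        (Set.disjoint_left.2 fun x hx hxA => hfrS x hx (hSA ▸ .inl hxA))
      obtain ⟨C, -, hC⟩ : ∃ C, 0 ≤ C ∧ ∀ x ∈ frontier (Ω' j), x ∈ Set.univ →
          logCosh (φt x) (φs j x) ≤ C := by
        refine hfr.exists_forall_le_of_local fun a ha =>
          ⟨logCosh (φt a) (φs j a) + 1, mem_nhdsWithin_of_mem_nhds ?_⟩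
        have haS := hfrS a ha
        have hcont : ContinuousAt (fun y => logCosh (φt y) (φs j y)) a :=
          ((hdata.contDiffAt_tilde hS (hP a haS)).logCosh (hdata.contDiffAt hS j haS)
            (hdata.mem_tilde (hP a haS)) (hdata.mem j haS)).continuousAt
        filter_upwards [hcont.eventually (gt_mem_nhds (lt_add_one _))] with x hx _ using hx.le
      refine ⟨M + C + Real.log 2, fun c r hball φ hφ x hx => ?_⟩
      refine hφ.logCosh_le_of_frontier hn0 hS hdata Metric.isOpen_ball hucd2 hΔu huS
        (hcover.isOpen j) (hcover.bounded j hj) (hball j hj) hsep (fun y hy => ?_) x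
        ⟨hx.1.1, notMem_iUnion_of_separates hsep (subset_closure hx.1.1) hx.2⟩
      have hyB : y ∈ Metric.ball c r \ ⋃ i, S i :=
        ⟨hball j hj (frontier_subset_closure hy.1), hy.2⟩
      have h1 := hle c r φ hφ y hyB
      have h2 := logCosh_triangle (hφ.harmonic.mapsTo ⟨subset_closure hyB.1, hyB.2⟩)
        (hdata.mem_tilde (hP y hy.2)) (hdata.mem j hy.2)
      linarith [hM y hy, hC y hy.1 trivial]
    · obtain ⟨C, hC⟩ := hcover.asymptotic j hj
      obtain ⟨M, hM⟩ := hvD (closure (Ω' j)) isClosed_closure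
        (hdisjA fun i hi => hsep i fun h => hj (h ▸ hi))
      refine ⟨M + C + Real.log 2, fun c r _ φ hφ x hx => ?_⟩
      have hxS := notMem_iUnion_of_separates hsep (subset_closure hx.1.1) hx.2
      have h1 := hle c r φ hφ x ⟨hx.1.2, hxS⟩
      have h2 := logCosh_triangle (hφ.harmonic.mapsTo ⟨subset_closure hx.1.2, hxS⟩)
        (hdata.mem_tilde (hP x hxS)) (hdata.mem j hxS)
      have h3 := logCosh_le_hypDist (hdata.mem_tilde (hP x hxS)) (hdata.mem j hxS)
      linarith [hM x ⟨subset_closure hx.1.1, hxS⟩, hC x ⟨hx.1.1, hx.2⟩]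
  choose Rj hRj using hRj
  have hlog : 0 < Real.log 2 := Real.log_pos one_lt_two
  refine ⟨|Mt| + ∑ j, |Rj j| + Real.log 2, by positivity, fun c r _ hball φ hφ =>
    ⟨fun x hx => ?_, fun j x hx => ?_⟩⟩
  · have hxS : x ∉ ⋃ i, S i := fun h => by
      obtain ⟨i, hi⟩ := Set.mem_iUnion.1 h
      exact Set.disjoint_left.1 (hcover.separates_tilde i) (subset_closure hx.1) hi
    have h1 := hle c r φ hφ x ⟨hx.2, hxS⟩
    have h2 := hypDist_le_logCosh_add (hφ.harmonic.mapsTo ⟨subset_closure hx.2, hxS⟩)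
      (hdata.mem_tilde (hP x hxS))
    have h3 : 0 ≤ ∑ j, |Rj j| := Finset.sum_nonneg fun j _ => abs_nonneg _
    linarith [hMt x ⟨subset_closure hx.1, hxS⟩, le_abs_self Mt]
  · have hxS := notMem_iUnion_of_separates (fun i hij => hcover.separates j i hij.symm)
      (subset_closure hx.1.1) hx.2
    have h1 := hRj j c r hball φ hφ x hx
    have h2 := hypDist_le_logCosh_add (hφ.harmonic.mapsTo ⟨subset_closure hx.1.2, hxS⟩)
      (hdata.mem j hxS)
    have h3 : |Rj j| ≤ ∑ j, |Rj j| :=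
      Finset.single_le_sum (fun j _ => abs_nonneg (Rj j)) (Finset.mem_univ j)
    linarith [le_abs_self (Rj j), abs_nonneg Mt]
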